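/- Let $k$ be a field of characteristic zero, $n\ge 0$, and let $P=k[x_1,\dots,x_n]$ or $P=k\{x_1,\dots,x_n\}$, the ring of power series that converge, with respect to a given absolute value on $k$, on some polydisc of positive radius around $0$. Let $f\in P$, $A=P/(f)$, write $f_{x_i}=\partial f/\partial x_i$, and write $J(f)=(f_{x_1},\dots,f_{x_n})$, also for the ideal it generates in $A$. For $q\ge 0$ let $Der^q(A)$ be the $A$-module of $k$-linear maps $D:A\to A$ with $$D(a_0\cdots a_q)=\sum_{s=1}^{q}(-1)^{s-1}\sum_{i_1<\cdots<i_s}a_{i_1}\cdots a_{i_s}\,D\Big(\prod_{j\ne i_1,\dots,i_s}a_j\Big)\qquad\text{for all } a_0,\dots,a_q\in A,$$ so that $Der^1(A)$ consists of the $k$-derivations of $A$, and let $der^q(A)$ be the $A$-module spanned by all compositions $\delta_1\cdots\delta_j$ with $1\le j\le q$ and $\delta_1,\dots,\delta_j\in Der^1(A)$. Let $I_i$ be the ideal of $A$ generated by all $D(x_i)$, $D\in Der^1(A)$. Let $D_{pq}=f_{x_p}\frac{\partial}{\partial x_q}-f_{x_q}\frac{\partial}{\partial x_p}\in Der^1(A)$,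 and $$\mathscr D^2(A)=\{(d_1,\dots,d_n)\in Der^1(A)^{n}: d_i(x_j)=d_j(x_i)\text{ for all }i,j\}.$$ A differential operator $D$ on $A$, regarded as an operator $P\to A$, is uniquely of the form $D=\sum_\alpha c_\alpha(D)\,\partial_x^{(\alpha)}$ with finitely many nonzero $c_\alpha(D)\in A$, where $\partial_x^{(\alpha)}=\frac1{\alpha!}\frac{\partial^{\alpha}}{\partial x^{\alpha}}$. For $D\in Der^2(A)$ set $\theta_2(D)=(\theta_2(D)_1,\dots,\theta_2(D)_n)$ with $$\theta_2(D)_i=\sum_\alpha c_{\alpha+e_i}(D)\,\partial_x^{(\alpha)}-c_{e_i}(D)\,\partial_x^{(0)},$$ where $e_i$ is the $i$-th unit vector; a tuple of derivations of $A$ is identified with the tuple of operators $P\to A$ it induces. Suppose that $d_1,\dots,d_n\in Der^1(A)$ satisfy $d_i(x_j)-d_j(x_i)\in J(f)$ for all $i,j$, and that for some $i$ the element $d_i(x_i)$ does not lie in the ideal $(I_i^2,\ f_{x_k}: k\ne i)$ of $A$. Then: 1. $(d_1,\dots,d_n)\notin\theta_2(der^2(A))$; 2. there is a tuple $(d_1',\dots,d_n')\in\mathscr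 D^2(A)$ such that every $d_i'-d_i$ is an $A$-linear combination of the $D_{pq}$, and no such corrected tuple lies in $\theta_2(der^2(A))$; 3. $der^2(A)\ne Der^2(A)$. -/

import Mathlib

noncomputable section

namespace Nakai

/-! ### Higher order derivations of a commutative algebra -/

section Algebra

variable (k : Type*) (A : Type*) [CommRing k] [CommRing A] [Algebra k A]

/-- `Der^q(A)`: the `A`-module of `q`-th order derivations of `A` over `k`, i.e. the `k`-linear maps
`D` such that `D (a₀ ⋯ a_q) = ∑_{s=1}^{q} (-1)^(s-1) ∑_{i₁<⋯<i_s} a_{i₁} ⋯ a_{i_s} D (∏ of the others)`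
for all `a₀, …, a_q`.  The sum runs over the nonempty proper subsets `S` of the indices. -/
def highDer (q : ℕ) : Submodule A (A →ₗ[k] A) where
  carrier := {D | ∀ a : Fin (q + 1) → A, D (∏ i, a i) =
    ∑ S : Finset (Fin (q + 1)) with S.Nonempty ∧ S ≠ Finset.univ,
      (-1) ^ (S.card + 1) * ((∏ i ∈ S, a i) * D (∏ i ∈ Sᶜ, a i))}
  add_mem' := by
    intro D E hD hE a
    simp only [LinearMap.add_apply, hD a, hE a, mul_add, Finset.sum_add_distrib]
  zero_mem' := by intro a; simp
  smul_mem' := by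
    intro c D hD a
    simp only [LinearMap.smul_apply, smul_eq_mul, hD a, Finset.mul_sum]
    refine Finset.sum_congr rfl fun S _ => ?_
    ring

/-- `der^q(A)`: the `A`-linear combinations of compositions `δ₁ δ₂ ⋯ δ_j`, `1 ≤ j ≤ q`, of
first order derivations. -/
def compDer (q : ℕ) : Submodule A (A →ₗ[k] A) :=
  Submodule.span A {D | ∃ l : List (Derivation k A A), 1 ≤ l.length ∧ l.length ≤ q ∧
    D = (l.map fun δ => ((δ : A →ₗ[k] A) : Module.End k A)).prod}

variable {k A}

/-- The first order derivations in the above sense are exactly the usual derivations. -/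
theorem mem_highDer_one (D : A →ₗ[k] A) :
    D ∈ highDer k A 1 ↔ ∃ δ : Derivation k A A, (δ : A →ₗ[k] A) = D := by
  have key : D ∈ highDer k A 1 ↔ ∀ a b : A, D (a * b) = a * D b + b * D a := by
    have hs : (Finset.univ.filter fun S : Finset (Fin (1 + 1)) =>
        S.Nonempty ∧ S ≠ Finset.univ) = {{0}, {1}} := by decide
    have h0 : ({0} : Finset (Fin (1 + 1)))ᶜ = {1} := by decide
    have h1 : ({1} : Finset (Fin (1 + 1)))ᶜ = {0} := by decide
    have hne : ({0} : Finset (Fin (1 + 1))) ≠ {1} := by decide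
    have e : D ∈ highDer k A 1 ↔ ∀ a : Fin (1 + 1) → A, D (a 0 * a 1) =
        a 0 * D (a 1) + a 1 * D (a 0) := by
      refine forall_congr' fun a => ?_
      rw [hs, Finset.sum_pair hne, h0, h1]
      simp [Fin.prod_univ_two]
    rw [e]
    exact ⟨fun h a b => by simpa using h ![a, b], fun h a => h _ _⟩
  rw [key]
  constructor
  · intro h
    exact ⟨Derivation.mk' D (by simpa using h), rfl⟩
  · rintro ⟨δ, rfl⟩ a b
    simp

end Algebra

/-! ### Polynomials and convergent power series -/

section Rings

variable {k : Type*} [Field k]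

/-- The power series `g` converges absolutely, with respect to the absolute value `v`, on some
polydisc of positive radius around the origin. -/
def IsConvergent (v : AbsoluteValue k ℝ) {n : ℕ} (g : MvPowerSeries (Fin n) k) : Prop :=
  ∃ r : ℝ, 0 < r ∧
    Summable fun α : Fin n →₀ ℕ => v (MvPowerSeries.coeff α g) * r ^ α.degree

theorem summable_mono (v : AbsoluteValue k ℝ) {n : ℕ} (u : MvPowerSeries (Fin n) k) {a b : ℝ}
    (ha : 0 < a) (hab : a ≤ b)
    (hb : Summable fun α : Fin n →₀ ℕ => v (MvPowerSeries.coeff α u) * b ^ α.degree) :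
    Summable fun α : Fin n →₀ ℕ => v (MvPowerSeries.coeff α u) * a ^ α.degree := by
  refine Summable.of_nonneg_of_le
    (fun α => mul_nonneg (v.nonneg _) (pow_nonneg ha.le _)) (fun α => ?_) hb
  exact mul_le_mul_of_nonneg_left (pow_le_pow_left₀ ha.le hab _) (v.nonneg _)

theorem IsConvergent.add {v : AbsoluteValue k ℝ} {n : ℕ} {g h : MvPowerSeries (Fin n) k}
    (hg : IsConvergent v g) (hh : IsConvergent v h) : IsConvergent v (g + h) := by
  obtain ⟨r, hr, hg⟩ := hg
  obtain ⟨s, hs, hh⟩ := hh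
  have hm : 0 < min r s := lt_min hr hs
  refine ⟨min r s, hm, ?_⟩
  refine Summable.of_nonneg_of_le
    (fun α => mul_nonneg (v.nonneg _) (pow_nonneg hm.le _)) (fun α => ?_)
    ((summable_mono v g hm (min_le_left _ _) hg).add (summable_mono v h hm (min_le_right _ _) hh))
  rw [map_add, ← add_mul]
  exact mul_le_mul_of_nonneg_right (v.add_le _ _) (pow_nonneg hm.le _)

theorem summable_convolution {n : ℕ} {F G : (Fin n →₀ ℕ) → ℝ} (hF0 : ∀ α, 0 ≤ F α)
    (hG0 : ∀ α, 0 ≤ G α) (hF : Summable F) (hG : Summable G) :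
    Summable fun α => ∑ p ∈ Finset.HasAntidiagonal.antidiagonal α, F p.1 * G p.2 :=
  summable_sum_mul_antidiagonal_of_summable_mul (hF.mul_of_nonneg hG hF0 hG0)

theorem IsConvergent.mul {v : AbsoluteValue k ℝ} {n : ℕ} {g h : MvPowerSeries (Fin n) k}
    (hg : IsConvergent v g) (hh : IsConvergent v h) : IsConvergent v (g * h) := by
  obtain ⟨r, hr, hg⟩ := hg
  obtain ⟨s, hs, hh⟩ := hh
  have hm : 0 < min r s := lt_min hr hs
  refine ⟨min r s, hm, ?_⟩
  have hg' := summable_mono v g hm (min_le_left _ _) hg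
  have hh' := summable_mono v h hm (min_le_right _ _) hh
  generalize min r s = t at hm hg' hh'
  have hc := summable_convolution
    (fun α => mul_nonneg (v.nonneg _) (pow_nonneg hm.le _))
    (fun α => mul_nonneg (v.nonneg _) (pow_nonneg hm.le _)) hg' hh'
  refine Summable.of_nonneg_of_le
    (fun α => mul_nonneg (v.nonneg _) (pow_nonneg hm.le _)) (fun α => ?_) hc
  rw [MvPowerSeries.coeff_mul]
  refine (mul_le_mul_of_nonneg_right (v.sum_le _ _) (pow_nonneg hm.le _)).trans (le_of_eq ?_)
  rw [Finset.sum_mul]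
  refine Finset.sum_congr rfl fun p hp => ?_
  rw [← Finset.HasAntidiagonal.mem_antidiagonal.mp hp, map_add, pow_add, map_mul]
  ring

theorem isConvergent_of_finite (v : AbsoluteValue k ℝ) {n : ℕ} (g : MvPowerSeries (Fin n) k)
    (s : Finset (Fin n →₀ ℕ)) (hs : ∀ α ∉ s, MvPowerSeries.coeff α g = 0) : IsConvergent v g :=
  ⟨1, one_pos, summable_of_ne_finset_zero (s := s) fun α hα => by rw [hs α hα]; simp⟩

theorem IsConvergent.pderiv {v : AbsoluteValue k ℝ} {n : ℕ} {g : MvPowerSeries (Fin n) k}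
    (hg : IsConvergent v g) (i : Fin n) : IsConvergent v (MvPowerSeries.pderiv k i g) := by
  obtain ⟨r, hr, hg⟩ := hg
  have hr2 : 0 < r / 2 := by positivity
  refine ⟨r / 2, hr2, ?_⟩
  have hinj : Function.Injective fun α : Fin n →₀ ℕ => α + Finsupp.single i 1 :=
    add_left_injective _
  have h1 := (hg.comp_injective hinj).mul_left (1 / r)
  refine Summable.of_nonneg_of_le
    (fun α => mul_nonneg (v.nonneg _) (pow_nonneg hr2.le _)) (fun α => ?_) h1
  rw [MvPowerSeries.coeff_pderiv, map_mul]
  have hnat : ∀ m : ℕ, v (m : k) ≤ m := by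
    intro m
    induction m with
    | zero => simp
    | succ m ih =>
      push_cast
      exact (v.add_le _ _).trans (by simpa using ih)
  have hv : v ((α i : k) + 1) ≤ 2 ^ α.degree := by
    have a1 : v ((α i : k) + 1) ≤ (α i : ℝ) + 1 := by
      have := hnat (α i + 1)
      push_cast at this
      exact this
    have a2 : α i + 1 ≤ 2 ^ α.degree :=
      (Nat.lt_two_pow_self (n := α i)).trans_le
        (Nat.pow_le_pow_right (by norm_num) (Finsupp.le_degree i α))
    exact a1.trans (by exact_mod_cast a2)
  have h0 := v.nonneg (MvPowerSeries.coeff (α + Finsupp.single i 1) g)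
  simp only [Function.comp, map_add, Finsupp.degree_single, pow_succ, div_pow]
  calc v (MvPowerSeries.coeff (α + Finsupp.single i 1) g) * v ((α i : k) + 1)
        * (r ^ α.degree / 2 ^ α.degree)
      ≤ v (MvPowerSeries.coeff (α + Finsupp.single i 1) g) * 2 ^ α.degree
        * (r ^ α.degree / 2 ^ α.degree) :=
        mul_le_mul_of_nonneg_right (mul_le_mul_of_nonneg_left hv h0) (by positivity)
    _ = _ := by field_simp

/-- The ring `k{x₁,…,xₙ}` of convergent power series. -/
def convergentSeries (v : AbsoluteValue k ℝ) (n : ℕ) : Subalgebra k (MvPowerSeries (Fin n) k) where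
  carrier := {g | IsConvergent v g}
  mul_mem' := IsConvergent.mul
  add_mem' := IsConvergent.add
  algebraMap_mem' := by
    classical
    intro c
    refine isConvergent_of_finite v _ {0} fun α hα => ?_
    rw [MvPowerSeries.algebraMap_apply, MvPowerSeries.coeff_C, if_neg (by simpa using hα)]

/-- The polynomials, as a subring of the formal power series. -/
def polynomialSeries (k : Type*) [Field k] (n : ℕ) : Subalgebra k (MvPowerSeries (Fin n) k) :=
  (MvPolynomial.coeToMvPowerSeries.algHom (σ := Fin n) (R := k) k).range

/-- The two kinds of base rings: polynomials, or convergent power series for a given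
absolute value on `k`. -/
inductive RingKind (k : Type*) [Field k]
  | polynomial : RingKind k
  | convergent (v : AbsoluteValue k ℝ) : RingKind k

/-- The base ring `P`: `k[x₁,…,xₙ]` or `k{x₁,…,xₙ}`. -/
def RingKind.ring (κ : RingKind k) (n : ℕ) : Subalgebra k (MvPowerSeries (Fin n) k) :=
  match κ with
  | .polynomial => polynomialSeries k n
  | .convergent v => convergentSeries v n

theorem RingKind.X_mem (κ : RingKind k) {n : ℕ} (i : Fin n) :
    (MvPowerSeries.X i : MvPowerSeries (Fin n) k) ∈ κ.ring n := by
  classical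
  cases κ with
  | polynomial => exact ⟨MvPolynomial.X i, by simp⟩
  | convergent v =>
    refine isConvergent_of_finite v _ {Finsupp.single i 1} fun α hα => ?_
    rw [MvPowerSeries.coeff_X, if_neg (by simpa using hα)]

theorem RingKind.pderiv_mem (κ : RingKind k) {n : ℕ} (i : Fin n)
    {g : MvPowerSeries (Fin n) k} (hg : g ∈ κ.ring n) :
    MvPowerSeries.pderiv k i g ∈ κ.ring n := by
  cases κ with
  | polynomial =>
    obtain ⟨p, rfl⟩ := hg
    refine ⟨MvPolynomial.pderiv i p, ?_⟩
    simp [MvPowerSeries.pderiv_coe]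
  | convergent v => exact IsConvergent.pderiv hg i

variable {κ : RingKind k} {n : ℕ}

/-- The coordinate `x_i` as an element of `P`. -/
def coord (κ : RingKind k) {n : ℕ} (i : Fin n) : κ.ring n := ⟨MvPowerSeries.X i, κ.X_mem i⟩

/-- The partial derivative `∂/∂x_i` of `P`. -/
def partialDer (κ : RingKind k) {n : ℕ} (i : Fin n) : Derivation k (κ.ring n) (κ.ring n) :=
  Derivation.mk'
    { toFun := fun g => ⟨MvPowerSeries.pderiv k i g.1, κ.pderiv_mem i g.2⟩
      map_add' := fun g h => Subtype.ext (by simp)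
      map_smul' := fun c g => Subtype.ext (by simp) }
    (fun g h => Subtype.ext (by simp))

/-- The divided power operator `∂_x^(α) = (1/α!) ∂^α/∂x^α` of `P`. -/
def divDer (κ : RingKind k) {n : ℕ} (α : Fin n →₀ ℕ) : κ.ring n →ₗ[k] κ.ring n :=
  (∏ i, (Nat.factorial (α i) : k))⁻¹ •
    ((List.finRange n).map fun i =>
      ((partialDer κ i : κ.ring n →ₗ[k] κ.ring n) : Module.End k (κ.ring n)) ^ α i).prod

/-! ### The hypersurface algebra `A = P/(f)` -/

/-- `A = P/(f)`. -/
def HypAlg (f : κ.ring n) : Type _ := κ.ring n ⧸ Ideal.span {f}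

instance (f : κ.ring n) : CommRing (HypAlg f) :=
  inferInstanceAs (CommRing (κ.ring n ⧸ Ideal.span {f}))

instance (f : κ.ring n) : Algebra k (HypAlg f) :=
  inferInstanceAs (Algebra k (κ.ring n ⧸ Ideal.span {f}))

/-- The projection `P → A`. -/
def proj (f : κ.ring n) : κ.ring n →ₐ[k] HypAlg f := Ideal.Quotient.mkₐ k (Ideal.span {f})

theorem proj_surjective (f : κ.ring n) : Function.Surjective (proj f) :=
  Ideal.Quotient.mk_surjective

theorem proj_eq_zero_iff (f g : κ.ring n) : proj f g = 0 ↔ g ∈ Ideal.span {f} :=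
  Ideal.Quotient.eq_zero_iff_mem

/-- The class of `x_i` in `A`. -/
def xbar (f : κ.ring n) (i : Fin n) : HypAlg f := proj f (coord κ i)

/-- The class of `f_{x_i} = ∂f/∂x_i` in `A`. -/
def fbar (f : κ.ring n) (i : Fin n) : HypAlg f := proj f (partialDer κ i f)

/-- The ideal of `A` generated by the Jacobi ideal `J(f) = (f_{x_1}, …, f_{x_n})`. -/
def jacobiIdeal (f : κ.ring n) : Ideal (HypAlg f) := Ideal.span (Set.range (fbar f))

/-- The ideal `I_i = ⟨D(x_i) : D ∈ Der^1(A)⟩` of `A`. -/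
def coordIdeal (f : κ.ring n) (i : Fin n) : Ideal (HypAlg f) :=
  Ideal.span {a | ∃ D : Derivation k (HypAlg f) (HypAlg f), a = D (xbar f i)}

theorem proj_hamiltonian (f : κ.ring n) (i j : Fin n) (g : κ.ring n) (hg : proj f g = 0) :
    proj f ((partialDer κ i f • partialDer κ j - partialDer κ j f • partialDer κ i) g) = 0 := by
  rw [proj_eq_zero_iff] at hg ⊢
  obtain ⟨h, rfl⟩ := Ideal.mem_span_singleton'.mp hg
  refine Ideal.mem_span_singleton'.mpr
    ⟨partialDer κ i f * partialDer κ j h - partialDer κ j f * partialDer κ i h, ?_⟩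
  simp only [Derivation.coe_sub, Derivation.coe_smul, Pi.sub_apply, Pi.smul_apply, smul_eq_mul,
    Derivation.leibniz]
  ring

/-- The Hamiltonian derivation `D_{ij} = f_{x_i} ∂/∂x_j - f_{x_j} ∂/∂x_i` of `A`. -/
def hamiltonian (f : κ.ring n) (i j : Fin n) : Derivation k (HypAlg f) (HypAlg f) :=
  Derivation.liftOfSurjective (f := proj f) (proj_surjective f)
    (proj_hamiltonian f i j)

/-- `𝒟²(A)`: the tuples of derivations of `A` with `d_i(x_j) = d_j(x_i)` for all `i, j`. -/
def symTuples (f : κ.ring n) : Set (Fin n → Derivation k (HypAlg f) (HypAlg f)) :=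
  {d | ∀ i j, d i (xbar f j) = d j (xbar f i)}

/-! ### The map `θ₂` -/

/-- An operator on `A`, regarded as an operator `P → A` through the projection. -/
def pull (f : κ.ring n) (D : HypAlg f →ₗ[k] HypAlg f) : κ.ring n →ₗ[k] HypAlg f :=
  D ∘ₗ (proj f).toLinearMap

/-- The operator `∑_α c_α ∂_x^(α) : P → A` with finitely many nonzero coefficients `c_α ∈ A`. -/
def opOfCoeff (f : κ.ring n) (c : (Fin n →₀ ℕ) →₀ HypAlg f) : κ.ring n →ₗ[k] HypAlg f :=
  c.sum fun α a => a • ((proj f).toLinearMap ∘ₗ divDer κ α)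

theorem coeff_partialDer_pow (i : Fin n) (m : ℕ) (β : Fin n →₀ ℕ) :
    ∃ K : ℕ, K ≠ 0 ∧ ∀ g : κ.ring n, MvPowerSeries.coeff β
      ((((partialDer κ i : κ.ring n →ₗ[k] κ.ring n) : Module.End k (κ.ring n)) ^ m) g).1 =
        K * MvPowerSeries.coeff (β + Finsupp.single i m) g.1 := by
  induction m with
  | zero => exact ⟨1, one_ne_zero, fun g => by simp⟩
  | succ m ih =>
    obtain ⟨K, hK, h⟩ := ih
    refine ⟨K * (β i + m + 1), by positivity, fun g => ?_⟩
    rw [pow_succ, Module.End.mul_apply, h]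
    change (K : k) * MvPowerSeries.coeff _ (MvPowerSeries.pderiv k i g.1) = _
    rw [MvPowerSeries.coeff_pderiv, add_assoc, ← Finsupp.single_add]
    simp only [Finsupp.add_apply, Finsupp.single_eq_same]
    push_cast
    ring

theorem coeff_divDer [CharZero k] (γ β : Fin n →₀ ℕ) :
    ∃ K : k, K ≠ 0 ∧ ∀ g : κ.ring n, MvPowerSeries.coeff β (divDer κ γ g).1 =
      K * MvPowerSeries.coeff (β + γ) g.1 := by
  have key : ∀ (l : List (Fin n)) (β : Fin n →₀ ℕ), ∃ K : ℕ, K ≠ 0 ∧ ∀ g : κ.ring n,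
      MvPowerSeries.coeff β ((l.map fun i =>
        ((partialDer κ i : κ.ring n →ₗ[k] κ.ring n) : Module.End k (κ.ring n)) ^ γ i).prod g).1 =
      K * MvPowerSeries.coeff (β + (l.map fun i => Finsupp.single i (γ i)).sum) g.1 := by
    intro l
    induction l with
    | nil => exact fun β => ⟨1, one_ne_zero, fun g => by simp⟩
    | cons i l ih =>
      intro β
      obtain ⟨K, hK, h⟩ := coeff_partialDer_pow (κ := κ) i (γ i) β
      obtain ⟨K', hK', h'⟩ := ih (β + Finsupp.single i (γ i))
      refine ⟨K * K', mul_ne_zero hK hK', fun g => ?_⟩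
      rw [List.map_cons, List.prod_cons, Module.End.mul_apply, h, h', List.map_cons,
        List.sum_cons, add_assoc]
      push_cast
      ring
  obtain ⟨K, hK, h⟩ := key (List.finRange n) β
  have hsum : ((List.finRange n).map fun i => Finsupp.single i (γ i)).sum = γ := by
    rw [← List.ofFn_eq_map, List.sum_ofFn, Finsupp.univ_sum_single]
  rw [hsum] at h
  have hfac : (∏ i, (Nat.factorial (γ i) : k)) ≠ 0 :=
    Finset.prod_ne_zero_iff.mpr fun i _ => by exact_mod_cast Nat.factorial_ne_zero _
  refine ⟨(∏ i, (Nat.factorial (γ i) : k))⁻¹ * K,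
    mul_ne_zero (inv_ne_zero hfac) (by exact_mod_cast hK), fun g => ?_⟩
  rw [mul_assoc, ← h g]
  rfl

/-- The expression of an operator `P → A` in the form `∑_α c_α ∂_x^(α)` is unique. -/
theorem opOfCoeff_injective [CharZero k] (f : κ.ring n) :
    Function.Injective (opOfCoeff f) := by
  classical
  have hzero : ∀ c : (Fin n →₀ ℕ) →₀ HypAlg f, opOfCoeff f c = 0 → c = 0 := by
    intro c hc
    by_contra hne
    obtain ⟨α, hα, hmin⟩ := Finset.exists_min_image c.support (fun α => α.degree)
      (Finsupp.support_nonempty_iff.mpr hne)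
    have hmem : (MvPowerSeries.monomial α (1 : k)) ∈ κ.ring n := by
      rw [MvPowerSeries.monomial_one_eq]
      exact Subalgebra.prod_mem _ fun i _ => Subalgebra.pow_mem _ (κ.X_mem i) _
    let g : κ.ring n := ⟨MvPowerSeries.monomial α (1 : k), hmem⟩
    have hoff : ∀ γ ∈ c.support, γ ≠ α → divDer κ γ g = 0 := by
      intro γ hγ hγα
      refine Subtype.ext (MvPowerSeries.ext fun β => ?_)
      obtain ⟨K, -, h⟩ := coeff_divDer (κ := κ) γ β
      rw [h g, MvPowerSeries.coeff_monomial, if_neg]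
      · simp
      · intro he
        have h1 := congrArg Finsupp.degree he
        rw [map_add] at h1
        have h2 := hmin γ hγ
        have h3 : β = 0 := (Finsupp.degree_eq_zero_iff β).mp (by omega)
        exact hγα (by simpa [h3] using he)
    obtain ⟨K, hK, h0⟩ := coeff_divDer (κ := κ) α 0
    have hon : divDer κ α g = algebraMap k _ K := by
      refine Subtype.ext (MvPowerSeries.ext fun β => ?_)
      change _ = MvPowerSeries.coeff β (algebraMap k (MvPowerSeries (Fin n) k) K)
      rw [MvPowerSeries.algebraMap_apply, MvPowerSeries.coeff_C]
      by_cases hβ : β = 0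
      · subst hβ
        rw [h0 g, zero_add, MvPowerSeries.coeff_monomial_same]
        simp
      · obtain ⟨K', -, h'⟩ := coeff_divDer (κ := κ) α β
        rw [h' g, MvPowerSeries.coeff_monomial, if_neg (by simpa using hβ), if_neg hβ, mul_zero]
    have hg : opOfCoeff f c g = 0 := by rw [hc]; rfl
    have hg' : opOfCoeff f c g = ∑ γ ∈ c.support, c γ * proj f (divDer κ γ g) := by
      simp [opOfCoeff, Finsupp.sum, LinearMap.sum_apply]
    rw [hg', Finset.sum_eq_single_of_mem α hα
      (fun γ hγ hγα => by rw [hoff γ hγ hγα, map_zero, mul_zero]), hon, AlgHom.commutes,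
      mul_comm, ← Algebra.smul_def, smul_eq_zero_iff_right hK] at hg
    exact Finsupp.mem_support_iff.mp hα hg
  intro c c' h
  rw [← sub_eq_zero]
  apply hzero
  have hsub : opOfCoeff f (c - c') = opOfCoeff f c - opOfCoeff f c' :=
    Finsupp.sum_sub_index fun α a b => LinearMap.ext fun g => by simp [sub_mul]
  rw [hsub, h, sub_self]

open Classical in
/-- The coefficients `c_α(L) ∈ A` in the expression `L = ∑_α c_α(L) ∂_x^(α)` of a differential
operator `L : P → A`; they are unique by `opOfCoeff_injective`.  (The value `0` is given
to maps without such an expression, which are not differential operators.) -/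
def opCoeff (f : κ.ring n) (L : κ.ring n →ₗ[k] HypAlg f) : (Fin n →₀ ℕ) →₀ HypAlg f :=
  if h : ∃ c, opOfCoeff f c = L then h.choose else 0

/-- `⟨L, x^β⟩ = ∑_α c_{α+β}(L) ∂_x^(α)`. -/
def pairing (f : κ.ring n) (L : κ.ring n →ₗ[k] HypAlg f) (β : Fin n →₀ ℕ) :
    κ.ring n →ₗ[k] HypAlg f :=
  opOfCoeff f ((opCoeff f L).comapDomain (fun α => α + β) (add_left_injective β).injOn)

/-- `Φ(L, β) = ⟨L, x^β⟩ - c_β(L) ∂_x^(0)`. -/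
def derPairing (f : κ.ring n) (L : κ.ring n →ₗ[k] HypAlg f) (β : Fin n →₀ ℕ) :
    κ.ring n →ₗ[k] HypAlg f :=
  pairing f L β - opCoeff f L β • ((proj f).toLinearMap ∘ₗ divDer κ 0)

/-- `θ₂(D) = (Φ(D, e_1), …, Φ(D, e_n))`, a tuple of operators `P → A`. -/
def theta₂ (f : κ.ring n) (D : HypAlg f →ₗ[k] HypAlg f) : Fin n → (κ.ring n →ₗ[k] HypAlg f) :=
  fun i => derPairing f (pull f D) (Finsupp.single i 1)

/-- The image `θ₂(der²(A))`, as a set of tuples of derivations of `A`; a derivation of `A` is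
identified with the operator `P → A` it induces. -/
def thetaImage (f : κ.ring n) : Set (Fin n → Derivation k (HypAlg f) (HypAlg f)) :=
  {d | ∃ D ∈ compDer k (HypAlg f) 2, ∀ i,
    theta₂ f D i = pull f (d i : HypAlg f →ₗ[k] HypAlg f)}

end Rings

end Nakai

end

noncomputable section

namespace Nakai

/-! ### Second order derivations and the square defect -/

section Algebra

variable {k A : Type*} [CommRing k] [CommRing A] [Algebra k A]

/-! Everything is detected by the square defect D(x_i²) - 2 x_i D(x_i), which is A-linear in D. It
kills derivations and sends δε to 2 δ(x_i) ε(x_i), so it maps der²(A) into I_i². If D has an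
expansion with coefficients c_α, the defect equals c_{2e_i}(D), and this is the value of θ₂(D)_i at
x_i. Hence a tuple in θ₂(der²(A)) has d_i(x_i) ∈ I_i² (`apply_xbar_mem_of_mem_thetaImage`).

A combination of the D_{pq} takes x_i into the ideal of the f_{x_j} with j ≠ i, so correcting the
tuple by such combinations preserves the obstruction. A symmetric correction exists by the linear
algebra behind the Koszul formula for a connection: prescribed antisymmetrization in two indices,
antisymmetry in another pair (`exists_symTuples_sub_mem`).

For der²(A) ≠ Der²(A), a symmetric tuple is realized by an operator with principal part 1/2 ∑
d_p(x_q) ∂_p∂_q (`exists_mem_highDer_two_squareDefect`). Its defect at x_i is d_i(x_i), which is not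
in I_i². A first order term makes the operator preserve (f); this needs the relation ∑ d_i(x_j)
f_{x_j} = 0, the chain rule for f.

The chain rule is immediate for polynomials. For convergent series a derivation into A is controlled
on the coordinates only up to arbitrarily high order, so one shows that (f) is closed: successive
approximation gives a formal quotient by f, and `IsConvergent.of_mul` shows that this quotient
converges. -/

theorem mem_highDer_two (D : A →ₗ[k] A) : D ∈ highDer k A 2 ↔
    ∀ a b c, D (a * b * c) = a * D (b * c) + b * D (a * c) + c * D (a * b)
      - a * b * D c - a * c * D b - b * c * D a := by
  have hs : (Finset.univ.filter fun S : Finset (Fin (2 + 1)) =>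
      S.Nonempty ∧ S ≠ Finset.univ) = {{0}, {1}, {2}, {0, 1}, {0, 2}, {1, 2}} := by decide
  have h0 : ({0} : Finset (Fin (2 + 1)))ᶜ = {1, 2} := by decide
  have h1 : ({1} : Finset (Fin (2 + 1)))ᶜ = {0, 2} := by decide
  have h2 : ({2} : Finset (Fin (2 + 1)))ᶜ = {0, 1} := by decide
  have h01 : ({0, 1} : Finset (Fin (2 + 1)))ᶜ = {2} := by decide
  have h02 : ({0, 2} : Finset (Fin (2 + 1)))ᶜ = {1} := by decide
  have h12 : ({1, 2} : Finset (Fin (2 + 1)))ᶜ = {0} := by decide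
  have c01 : (0 : Fin (2 + 1)) ≠ 1 := by decide
  have c02 : (0 : Fin (2 + 1)) ≠ 2 := by decide
  have c12 : (1 : Fin (2 + 1)) ≠ 2 := by decide
  have e : D ∈ highDer k A 2 ↔ ∀ a : Fin (2 + 1) → A, D (a 0 * a 1 * a 2) =
      a 0 * D (a 1 * a 2) + a 1 * D (a 0 * a 2) + a 2 * D (a 0 * a 1)
      - a 0 * a 1 * D (a 2) - a 0 * a 2 * D (a 1) - a 1 * a 2 * D (a 0) := by
    refine forall_congr' fun a => ?_
    rw [hs, Finset.sum_insert (by decide), Finset.sum_insert (by decide),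
      Finset.sum_insert (by decide), Finset.sum_insert (by decide),
      Finset.sum_pair (by decide), h0, h1, h2, h01, h02, h12, Fin.prod_univ_three]
    simp only [Finset.prod_pair c01, Finset.prod_pair c02,
      Finset.prod_pair c12, Finset.prod_singleton, Finset.card_singleton, Finset.card_pair c01,
      Finset.card_pair c02, Finset.card_pair c12]
    refine Eq.congr rfl ?_
    ring
  rw [e]
  exact ⟨fun h a b c => h ![a, b, c], fun h a => h _ _ _⟩

theorem derivation_mem_highDer_two (δ : Derivation k A A) :
    (δ : A →ₗ[k] A) ∈ highDer k A 2 := by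
  refine (mem_highDer_two _).2 fun a b c => ?_
  simp only [Derivation.coeFn_coe, Derivation.leibniz, smul_eq_mul]
  ring

theorem derivation_comp_mem_highDer_two (δ ε : Derivation k A A) :
    (δ : A →ₗ[k] A) ∘ₗ (ε : A →ₗ[k] A) ∈ highDer k A 2 := by
  refine (mem_highDer_two _).2 fun a b c => ?_
  simp only [LinearMap.comp_apply, Derivation.coeFn_coe, Derivation.leibniz, smul_eq_mul,
    map_add]
  ring

/-- The value of `D` at `x²` minus the value forced on derivations, as a function of `D`. -/
def squareDefect (k : Type*) [CommRing k] [Algebra k A] (x : A) : (A →ₗ[k] A) →ₗ[A] A where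
  toFun D := D (x ^ 2) - 2 * x * D x
  map_add' D E := by simp only [LinearMap.add_apply]; ring
  map_smul' a D := by simp only [LinearMap.smul_apply, smul_eq_mul, RingHom.id_apply]; ring

theorem squareDefect_apply (x : A) (D : A →ₗ[k] A) :
    squareDefect k x D = D (x ^ 2) - 2 * x * D x := rfl

theorem squareDefect_derivation (x : A) (δ : Derivation k A A) :
    squareDefect k x (δ : A →ₗ[k] A) = 0 := by
  simp only [squareDefect_apply, Derivation.coeFn_coe, pow_two, Derivation.leibniz, smul_eq_mul]
  ring

/-- Only the cross terms of the Leibniz rule survive: the two terms containing δ(ε x) are cancelled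
by the correction. -/
theorem squareDefect_comp (x : A) (δ ε : Derivation k A A) :
    squareDefect k x ((δ : A →ₗ[k] A) ∘ₗ (ε : A →ₗ[k] A)) = 2 * (δ x * ε x) := by
  simp only [squareDefect_apply, LinearMap.comp_apply, Derivation.coeFn_coe, pow_two,
    Derivation.leibniz, smul_eq_mul, map_add]
  ring

/-- By A-linearity of the defect only the generators matter: a single derivation gives 0, a
composite of two gives twice a product of two generators of the ideal. -/
theorem squareDefect_mem_of_mem_compDer (x : A) {D : A →ₗ[k] A} (hD : D ∈ compDer k A 2) :
    squareDefect k x D ∈ Ideal.span {a | ∃ δ : Derivation k A A, a = δ x} ^ 2 := by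
  induction hD using Submodule.span_induction with
  | zero => simp
  | add D E _ _ hD hE => rw [map_add]; exact add_mem hD hE
  | smul a D _ hD => rw [map_smul]; exact Ideal.mul_mem_left _ _ hD
  | mem D hD =>
    obtain ⟨l, h1, h2, rfl⟩ := hD
    match l, h1, h2 with
    | [δ], _, _ =>
      simp only [List.bind_eq_flatMap, List.pure_def, List.flatMap_cons, List.flatMap_nil,
        List.cons_append, List.nil_append, List.map_cons, List.map_nil, List.prod_cons,
        List.prod_nil, mul_one]
      rw [squareDefect_derivation]
      exact zero_mem _
    | [δ, ε], _, _ =>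
      simp only [List.bind_eq_flatMap, List.pure_def, List.flatMap_cons, List.flatMap_nil,
        List.cons_append, List.nil_append, List.map_cons, List.map_nil, List.prod_cons,
        List.prod_nil, mul_one]
      rw [Module.End.mul_eq_comp, squareDefect_comp, pow_two]
      exact Ideal.mul_mem_left _ _ (Ideal.mul_mem_mul (Ideal.subset_span ⟨δ, rfl⟩)
        (Ideal.subset_span ⟨ε, rfl⟩))

/-- Second order derivations descend along surjections. -/
theorem mem_highDer_two_of_surjective {B : Type*} [CommRing B] [Algebra k B] {π : A →ₐ[k] B}
    (hπ : Function.Surjective π) {T : A →ₗ[k] A} (hT : T ∈ highDer k A 2) {D : B →ₗ[k] B}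
    (hD : ∀ g, D (π g) = π (T g)) : D ∈ highDer k B 2 := by
  refine (mem_highDer_two _).2 fun a b c => ?_
  obtain ⟨a, rfl⟩ := hπ a
  obtain ⟨b, rfl⟩ := hπ b
  obtain ⟨c, rfl⟩ := hπ c
  simp only [← map_mul, hD, (mem_highDer_two T).1 hT a b c, map_add, map_sub]

end Algebra

/-! ### Reading off coefficients of operators, and the obstruction on the image of θ₂ -/

section Coefficients

variable {k : Type*} [Field k] {κ : RingKind k} {n : ℕ}

theorem partialDer_coord (i j : Fin n) :
    partialDer κ i (coord κ j) = if j = i then 1 else 0 := by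
  refine Subtype.ext ?_
  change MvPowerSeries.pderiv k i (MvPowerSeries.X j) = _
  split_ifs with h
  · subst h; exact MvPowerSeries.pderiv_X_self
  · exact MvPowerSeries.pderiv_X_of_ne h

theorem divDer_single (i : Fin n) (m : ℕ) : divDer κ (Finsupp.single i m) =
    (Nat.factorial m : k)⁻¹ •
      ((partialDer κ i : κ.ring n →ₗ[k] κ.ring n) : Module.End k (κ.ring n)) ^ m := by
  classical
  unfold divDer
  rw [List.prod_map_eq_pow_single i, Finset.prod_eq_single i]
  · rw [List.count_eq_one_of_mem (List.nodup_finRange n) (List.mem_finRange i)]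
    simp
  · intro j _ hj
    simp [Finsupp.single_eq_of_ne hj]
  · simp
  · intro j hj _
    simp [Finsupp.single_eq_of_ne hj]

/-- Up to scalars, `divDer κ α` shifts exponents down by α, so it can act nontrivially on x_i^m only
if α ≤ m e_i. -/
theorem divDer_coord_pow_eq_zero [CharZero k] (i : Fin n) (m : ℕ) {α : Fin n →₀ ℕ}
    (hα : ∀ j ≤ m, α ≠ Finsupp.single i j) : divDer κ α (coord κ i ^ m) = 0 := by
  classical
  refine Subtype.ext (MvPowerSeries.ext fun β => ?_)
  obtain ⟨K, -, h⟩ := coeff_divDer (κ := κ) α β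
  rw [h]
  change K * MvPowerSeries.coeff (β + α) (MvPowerSeries.X i ^ m) = 0
  rw [MvPowerSeries.coeff_X_pow, if_neg, mul_zero]
  intro hβ
  have hle : ∀ s, β s + α s = Finsupp.single i m s := fun s => by rw [← hβ]; rfl
  refine hα (α i) ?_ ?_
  · have := hle i
    rw [Finsupp.single_eq_same] at this
    omega
  · ext s
    by_cases hs : s = i
    · subst hs; simp
    · have := hle s
      rw [Finsupp.single_eq_of_ne hs] at this ⊢
      omega

theorem opOfCoeff_coord_pow [CharZero k] (f : κ.ring n) (c : (Fin n →₀ ℕ) →₀ HypAlg f)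
    (i : Fin n) (m : ℕ) : opOfCoeff f c (coord κ i ^ m) = ∑ j ∈ Finset.range (m + 1),
      c (Finsupp.single i j) * proj f (divDer κ (Finsupp.single i j) (coord κ i ^ m)) := by
  classical
  have h1 : opOfCoeff f c (coord κ i ^ m) =
      ∑ α ∈ c.support, c α * proj f (divDer κ α (coord κ i ^ m)) := by
    simp [opOfCoeff, Finsupp.sum, LinearMap.sum_apply]
  have hinj : Set.InjOn (fun j => Finsupp.single i j : ℕ → Fin n →₀ ℕ)
      (Finset.range (m + 1) : Set ℕ) := (Finsupp.single_injective i).injOn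
  rw [h1, ← Finset.sum_image (f := fun α => c α * proj f (divDer κ α (coord κ i ^ m))) hinj]
  set s := (Finset.range (m + 1)).image fun j => Finsupp.single i j with hs
  -- Both sums are extended to the union of their index sets: outside `s` the operators vanish on
  -- x_i^m, outside the support the coefficients vanish.
  rw [Finset.sum_subset (Finset.subset_union_left : c.support ⊆ c.support ∪ s),
    Finset.sum_subset (Finset.subset_union_right : s ⊆ c.support ∪ s)]
  · intro α _ hα
    rw [divDer_coord_pow_eq_zero, map_zero, mul_zero]
    rintro j hj rfl
    exact hα (Finset.mem_image_of_mem _ (Finset.mem_range.mpr (by omega)))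
  · intro α _ hα
    rw [Finsupp.notMem_support_iff.mp hα, zero_mul]

/-- Evaluating the expansion of D at 1, x_i, x_i² gives in turn c_0 = 0, c_{e_i} = D(x_i) and
c_{2e_i} equal to the defect. In θ₂(D)_i(x_i) = c_{e_i} x_i + c_{2e_i} - c_{e_i} x_i only the defect
remains. The first alternative covers operators without a finite expansion, so that no expansion
theorem for der²(A) is needed. -/
theorem theta₂_coord [CharZero k] (f : κ.ring n) (D : HypAlg f →ₗ[k] HypAlg f) (hD : D 1 = 0)
    (i : Fin n) : theta₂ f D i (coord κ i) = 0 ∨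
      theta₂ f D i (coord κ i) = squareDefect k (xbar f i) D := by
  classical
  by_cases h : ∃ c, opOfCoeff f c = pull f D
  · right
    have hc : opOfCoeff f (opCoeff f (pull f D)) = pull f D := by
      rw [opCoeff, dif_pos h]; exact h.choose_spec
    set c := opCoeff f (pull f D) with hcdef
    have e0 : divDer κ (Finsupp.single i 0) = LinearMap.id := by
      rw [divDer_single]; simp; rfl
    have e0' : divDer κ (0 : Fin n →₀ ℕ) = LinearMap.id := by
      rw [← e0, Finsupp.single_zero]
    have e1 : divDer κ (Finsupp.single i 1) = (partialDer κ i : κ.ring n →ₗ[k] κ.ring n) := by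
      rw [divDer_single]; simp
    have hx : partialDer κ i (coord κ i) = 1 := by rw [partialDer_coord, if_pos rfl]
    have e2 : divDer κ (Finsupp.single i 2) (coord κ i ^ 2) = 1 := by
      rw [divDer_single, LinearMap.smul_apply, pow_two, Module.End.mul_apply]
      simp only [Derivation.coeFn_coe, pow_two, Derivation.leibniz, hx, smul_eq_mul, mul_one,
        map_add, Nat.factorial]
      rw [← two_smul k (1 : κ.ring n), smul_smul]
      norm_num
    have h0 := LinearMap.congr_fun hc (coord κ i ^ 0)
    have h1 := LinearMap.congr_fun hc (coord κ i ^ 1)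
    have h2 := LinearMap.congr_fun hc (coord κ i ^ 2)
    rw [opOfCoeff_coord_pow] at h0 h1 h2
    simp only [Finset.sum_range_succ, Finset.sum_range_zero, zero_add, e0, e1, e2, pow_zero,
      pow_one, LinearMap.id_apply, Derivation.coeFn_coe, hx, map_one, mul_one] at h0 h1 h2
    have hp : partialDer κ i (coord κ i ^ 2) = 2 * coord κ i := by
      simp only [pow_two, Derivation.leibniz, hx, smul_eq_mul]; ring
    have p0 : pull f D 1 = 0 := by
      change D (proj f 1) = 0
      rw [map_one, hD]
    have p1 : pull f D (coord κ i) = D (xbar f i) := rfl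
    have p2 : pull f D (coord κ i ^ 2) = D (xbar f i ^ 2) := by
      change D (proj f (coord κ i ^ 2)) = _
      rw [map_pow]; rfl
    rw [p0] at h0
    rw [p1, h0, zero_mul, zero_add] at h1
    rw [p2, h0, h1, zero_mul, zero_add, hp, map_mul, map_ofNat] at h2
    have h3 := opOfCoeff_coord_pow f (c.comapDomain (fun α => α + Finsupp.single i 1)
      (add_left_injective (Finsupp.single i 1)).injOn) i 1
    simp only [Finset.sum_range_succ, Finset.sum_range_zero, zero_add, e0, e1,
      pow_one, LinearMap.id_apply, Derivation.coeFn_coe, hx, map_one, mul_one,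
      Finsupp.comapDomain_apply, ← Finsupp.single_add] at h3
    change opOfCoeff f (c.comapDomain (fun α => α + Finsupp.single i 1)
      (add_left_injective (Finsupp.single i 1)).injOn) (coord κ i) -
        c (Finsupp.single i 1) * proj f (divDer κ 0 (coord κ i)) = _
    rw [h3, e0', squareDefect_apply, ← h2, h1]
    change _ - _ * xbar f i = _
    change _ * xbar f i + _ - _ = _ * (_ * xbar f i) + _ - _
    ring
  · left
    -- Here the default value 0 of `opCoeff` enters.
    have hc : opCoeff f (pull f D) = 0 := by rw [opCoeff, dif_neg h]
    simp only [theta₂, derPairing, pairing, hc]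
    simp [opOfCoeff, Finsupp.sum]

theorem apply_one_of_mem_compDer {A : Type*} [CommRing A] [Algebra k A] {q : ℕ} {D : A →ₗ[k] A}
    (hD : D ∈ compDer k A q) : D 1 = 0 := by
  induction hD using Submodule.span_induction with
  | zero => rfl
  | add D E _ _ hD hE => simp [hD, hE]
  | smul a D _ hD => simp [hD]
  | mem D hD =>
    obtain ⟨l, h1, -, rfl⟩ := hD
    have : l ≠ [] := by rintro rfl; simp at h1
    rw [← List.dropLast_append_getLast this]
    simp [List.bind_eq_flatMap]

/-- The obstruction: both alternatives of `theta₂_coord`, zero and the defect, lie in I_i². -/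
theorem apply_xbar_mem_of_mem_thetaImage [CharZero k] (f : κ.ring n)
    {d : Fin n → Derivation k (HypAlg f) (HypAlg f)} (hd : d ∈ thetaImage f) (i : Fin n) :
    d i (xbar f i) ∈ coordIdeal f i ^ 2 := by
  obtain ⟨D, hD, h⟩ := hd
  have e : d i (xbar f i) = theta₂ f D i (coord κ i) := by rw [h i]; rfl
  rw [e]
  rcases theta₂_coord f D (apply_one_of_mem_compDer hD) i with h0 | h0
  · rw [h0]; exact zero_mem _
  · rw [h0]; exact squareDefect_mem_of_mem_compDer _ hD

end Coefficients

/-! ### Convergence of quotients of power series -/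

section Convergence

variable {k : Type*} [Field k]

theorem summable_pow_degree {r : ℝ} (h0 : 0 ≤ r) (h1 : r < 1) (n : ℕ) :
    Summable fun α : Fin n →₀ ℕ => r ^ α.degree := by
  have key : ∀ n : ℕ, Summable fun α : Fin n → ℕ => r ^ ∑ i, α i := by
    intro n
    induction n with
    | zero => exact (hasSum_fintype _).summable
    | succ n ih =>
      have h := (summable_geometric_of_lt_one h0 h1).mul_of_nonneg ih (fun _ => by positivity)
        (fun _ => by positivity)
      rw [← (Fin.consEquiv fun _ => ℕ).summable_iff]
      refine h.congr fun p => ?_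
      simp [Fin.consEquiv, Fin.sum_univ_succ, pow_add]
  rw [← Finsupp.equivFunOnFinite.symm.summable_iff]
  refine (key n).congr fun α => ?_
  simp [Finsupp.degree_eq_sum]

theorem weight_eq_sum {n : ℕ} (w : Fin n → ℕ) (β : Fin n →₀ ℕ) :
    Finsupp.weight w β = ∑ i, β i * w i := by
  rw [Finsupp.weight_apply, Finsupp.sum_fintype _ _ (by simp)]
  rfl

/-- With W bounding the weights, the weight is at most W times the degree, so a bound at weighted
radius t is one at radius t^W; halving that radius gives a convergent geometric majorant. -/
theorem isConvergent_of_le (v : AbsoluteValue k ℝ) {n : ℕ} {h : MvPowerSeries (Fin n) k}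
    {w : Fin n → ℕ} {t C : ℝ} (ht : 0 < t) (ht1 : t < 1)
    (hC : ∀ β, v (MvPowerSeries.coeff β h) * t ^ Finsupp.weight w β ≤ C) : IsConvergent v h := by
  obtain ⟨W, hW⟩ : ∃ W, ∀ i, w i ≤ W := ⟨∑ i, w i, fun i =>
    Finset.single_le_sum (f := w) (fun _ _ => Nat.zero_le _) (Finset.mem_univ i)⟩
  have hweight : ∀ β : Fin n →₀ ℕ, Finsupp.weight w β ≤ W * β.degree := by
    intro β
    rw [weight_eq_sum, Finsupp.degree_eq_sum, Finset.mul_sum]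
    exact Finset.sum_le_sum fun i _ => by
      rw [mul_comm]; exact Nat.mul_le_mul_right _ (hW i)
  refine ⟨t ^ W / 2, by positivity, ?_⟩
  refine Summable.of_nonneg_of_le (fun β => mul_nonneg (v.nonneg _) (by positivity)) (fun β => ?_)
    ((summable_pow_degree (r := 1 / 2) (by norm_num) (by norm_num) n).mul_left C)
  have h2 : t ^ (W * β.degree) ≤ t ^ Finsupp.weight w β :=
    pow_le_pow_of_le_one ht.le ht1.le (hweight β)
  calc v (MvPowerSeries.coeff β h) * (t ^ W / 2) ^ β.degree
      = v (MvPowerSeries.coeff β h) * t ^ (W * β.degree) * (1 / 2) ^ β.degree := by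
        rw [div_eq_mul_one_div, mul_pow, ← pow_mul, mul_assoc]
    _ ≤ v (MvPowerSeries.coeff β h) * t ^ Finsupp.weight w β * (1 / 2) ^ β.degree :=
        mul_le_mul_of_nonneg_right (mul_le_mul_of_nonneg_left h2 (v.nonneg _)) (by positivity)
    _ ≤ C * (1 / 2) ^ β.degree := mul_le_mul_of_nonneg_right (hC β) (by positivity)

/-- Some positive weight singles out one monomial of a nonzero power series. -/
theorem exists_weight_lt {n : ℕ} {f : MvPowerSeries (Fin n) k} (hf : f ≠ 0) :
    ∃ (w : Fin n → ℕ) (α : Fin n →₀ ℕ), (∀ i, 0 < w i) ∧ MvPowerSeries.coeff α f ≠ 0 ∧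
      ∀ γ ≠ α, MvPowerSeries.coeff γ f ≠ 0 → Finsupp.weight w α < Finsupp.weight w γ := by
  classical
  obtain ⟨β, hβ, hord⟩ := MvPowerSeries.exists_coeff_ne_zero_and_order
    (MvPowerSeries.ne_zero_iff_order_finite.mp hf)
  set r := β.degree with hr
  have hlow : ∀ γ, MvPowerSeries.coeff γ f ≠ 0 → r ≤ γ.degree := by
    intro γ hγ
    have h1 := MvPowerSeries.order_le hγ
    rw [← hord] at h1
    exact_mod_cast h1
  -- In degree r all exponents are at most r, so they are the base r+1 digits of the `s`-weight,
  -- which therefore separates monomials of degree r. The constant M exceeds every such `s`-weight,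
  -- so that `w` compares the lowest degree first and breaks ties by `s`.
  let s : Fin n → ℕ := fun i => (r + 1) ^ (i : ℕ)
  let M : ℕ := r * (r + 1) ^ n + 1
  let w : Fin n → ℕ := fun i => M + s i
  have hw : ∀ γ, Finsupp.weight w γ = M * γ.degree + Finsupp.weight s γ := by
    intro γ
    rw [weight_eq_sum, weight_eq_sum, Finsupp.degree_eq_sum, Finset.mul_sum,
      ← Finset.sum_add_distrib]
    exact Finset.sum_congr rfl fun i _ => by simp only [w]; ring
  have hs : ∀ γ : Fin n →₀ ℕ, γ.degree = r → Finsupp.weight s γ < M := by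
    intro γ hγ
    rw [weight_eq_sum]
    refine Nat.lt_succ_of_le ?_
    have e : r * (r + 1) ^ n = ∑ i, γ i * (r + 1) ^ n := by
      rw [← Finset.sum_mul, ← Finsupp.degree_eq_sum, hγ]
    rw [e]
    refine Finset.sum_le_sum fun i _ => ?_
    exact Nat.mul_le_mul_left _ (Nat.pow_le_pow_right (by omega) i.2.le)
  have hinj : ∀ γ δ : Fin n →₀ ℕ, γ.degree = r → δ.degree = r →
      Finsupp.weight s γ = Finsupp.weight s δ → γ = δ := by
    intro γ δ hγ hδ h
    have e : ∀ ε : Fin n →₀ ℕ, Finsupp.weight s ε =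
        Nat.ofDigits (r + 1) (List.ofFn fun i => ε i) := by
      intro ε
      rw [weight_eq_sum, Nat.ofDigits_eq_sum_mapIdx]
      simp [List.mapIdx_eq_ofFn, List.sum_ofFn, s]
    rw [e, e] at h
    have hb : ∀ ε : Fin n →₀ ℕ, ε.degree = r →
        ∀ l ∈ List.ofFn (fun i => ε i), l < r + 1 := by
      intro ε hε l hl
      obtain ⟨i, rfl⟩ := (List.mem_ofFn' _ _).mp hl
      exact Nat.lt_succ_of_le (hε ▸ Finsupp.le_degree i ε)
    -- For r = 0 the base would be 1, where digits are not unique.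
    by_cases hr0 : r = 0
    · rw [hr0] at hγ hδ
      rw [(Finsupp.degree_eq_zero_iff γ).mp hγ, (Finsupp.degree_eq_zero_iff δ).mp hδ]
    · have h3 := Nat.ofDigits_inj_of_len_eq (by omega) (by simp) (hb γ hγ) (hb δ hδ) h
      exact Finsupp.ext fun i => congrFun (List.ofFn_injective h3) i
  have hne : ∃ m γ, MvPowerSeries.coeff γ f ≠ 0 ∧ Finsupp.weight w γ = m := ⟨_, β, hβ, rfl⟩
  obtain ⟨α, hα, hαm⟩ := Nat.find_spec hne
  have hmin : ∀ γ, MvPowerSeries.coeff γ f ≠ 0 → Finsupp.weight w α ≤ Finsupp.weight w γ :=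
    fun γ hγ => hαm ▸ Nat.find_min' hne ⟨γ, hγ, rfl⟩
  have hdeg : ∀ γ, MvPowerSeries.coeff γ f ≠ 0 → Finsupp.weight w γ ≤ Finsupp.weight w β →
      γ.degree = r := by
    intro γ hγ h
    refine le_antisymm ?_ (hlow γ hγ)
    by_contra hlt
    rw [hw, hw, ← hr] at h
    have h1 := hs β rfl
    have h2 : M * (r + 1) ≤ M * γ.degree := Nat.mul_le_mul_left _ (by omega)
    rw [mul_add] at h2
    omega
  refine ⟨w, α, fun i => by simp [w, M], hα, fun γ hγα hγ => ?_⟩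
  refine lt_of_le_of_ne (hmin γ hγ) fun h => hγα ?_
  have d1 := hdeg α hα (hmin β hβ)
  have d2 := hdeg γ hγ (h ▸ hmin β hβ)
  refine hinj γ α d2 d1 ?_
  rw [hw, hw, d1, d2] at h
  omega

/-- At a small weighted radius one monomial α of f outweighs all the others together by a factor 2.
Solving the product for the coefficients of h then gives a uniform weighted bound by induction on
the weight. -/
theorem IsConvergent.of_mul {v : AbsoluteValue k ℝ} {n : ℕ} {f h : MvPowerSeries (Fin n) k}
    (hf0 : f ≠ 0) (hf : IsConvergent v f) (hfh : IsConvergent v (f * h)) : IsConvergent v h := by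
  classical
  obtain ⟨w, α, hw, hα, hmin⟩ := exists_weight_lt hf0
  have hc : 0 < v (MvPowerSeries.coeff α f) := v.pos hα
  obtain ⟨r, hr, hf⟩ := hf
  obtain ⟨s, hs, hg⟩ := hfh
  have hdw : ∀ β : Fin n →₀ ℕ, β.degree ≤ Finsupp.weight w β := by
    intro β
    rw [weight_eq_sum, Finsupp.degree_eq_sum]
    exact Finset.sum_le_sum fun i _ => Nat.le_mul_of_pos_right _ (hw i)
  -- passing from a radius to a weight
  obtain ⟨ρ, hρ, hρ1, hρr, hρs⟩ : ∃ ρ : ℝ, 0 < ρ ∧ ρ < 1 ∧ ρ ≤ r ∧ ρ ≤ s :=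
    ⟨min (1 / 2) (min r s), by positivity, by
      exact lt_of_le_of_lt (min_le_left _ _) (by norm_num),
      (min_le_right _ _).trans (min_le_left _ _), (min_le_right _ _).trans (min_le_right _ _)⟩
  have htow : ∀ u : MvPowerSeries (Fin n) k,
      (Summable fun β : Fin n →₀ ℕ => v (MvPowerSeries.coeff β u) * ρ ^ β.degree) →
      Summable fun β => v (MvPowerSeries.coeff β u) * ρ ^ Finsupp.weight w β := fun u hu =>
    Summable.of_nonneg_of_le (fun β => mul_nonneg (v.nonneg _) (by positivity))
      (fun β => mul_le_mul_of_nonneg_left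
        (pow_le_pow_of_le_one hρ.le hρ1.le (hdw β)) (v.nonneg _)) hu
  have hfw := htow f (summable_mono v f hρ hρr hf)
  have hgw := htow _ (summable_mono v _ hρ hρs hg)
  set a := v (MvPowerSeries.coeff α f) with ha
  set F := ∑' β, v (MvPowerSeries.coeff β f) * ρ ^ Finsupp.weight w β with hF
  have hF0 : 0 ≤ F := tsum_nonneg fun β => mul_nonneg (v.nonneg _) (by positivity)
  set N := Finsupp.weight w α with hN
  -- a small radius at which the monomial `α` dominates `f`
  obtain ⟨ε, hε, hε1, hεF⟩ : ∃ ε : ℝ, 0 < ε ∧ ε ≤ 1 ∧ ε * F ≤ a * ρ ^ N / 2 := by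
    have hp : 0 < a * ρ ^ N / 2 := by positivity
    refine ⟨min 1 (a * ρ ^ N / 2 / (F + 1)), by positivity, min_le_left _ _, ?_⟩
    calc min 1 (a * ρ ^ N / 2 / (F + 1)) * F
        ≤ a * ρ ^ N / 2 / (F + 1) * (F + 1) :=
          mul_le_mul (min_le_right _ _) (by linarith) hF0 (by positivity)
      _ = a * ρ ^ N / 2 := by field_simp
  set t := ε * ρ with ht
  have ht0 : 0 < t := by positivity
  have ht1 : t < 1 := by nlinarith
  -- Every other monomial of f has weight at least N + 1, so shrinking ρ to ερ gains ε^(N+1); the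
  -- one factor beyond ε^N absorbs F.
  have htail : ∀ S : Finset (Fin n →₀ ℕ), α ∉ S →
      ∑ γ ∈ S, v (MvPowerSeries.coeff γ f) * t ^ Finsupp.weight w γ ≤ a * t ^ N / 2 := by
    intro S hS
    calc ∑ γ ∈ S, v (MvPowerSeries.coeff γ f) * t ^ Finsupp.weight w γ
        ≤ ∑ γ ∈ S, ε ^ (N + 1) *
            (v (MvPowerSeries.coeff γ f) * ρ ^ Finsupp.weight w γ) := by
          refine Finset.sum_le_sum fun γ hγ => ?_
          by_cases h0 : MvPowerSeries.coeff γ f = 0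
          · simp [h0]
          · have h1 := hmin γ (fun h => hS (h ▸ hγ)) h0
            have h2 : ε ^ Finsupp.weight w γ ≤ ε ^ (N + 1) :=
              pow_le_pow_of_le_one hε.le hε1 h1
            rw [ht, mul_pow]
            calc _ = ε ^ Finsupp.weight w γ *
                  (v (MvPowerSeries.coeff γ f) * ρ ^ Finsupp.weight w γ) := by ring
              _ ≤ _ := mul_le_mul_of_nonneg_right h2
                  (mul_nonneg (v.nonneg _) (by positivity))
      _ = ε ^ (N + 1) * ∑ γ ∈ S, v (MvPowerSeries.coeff γ f) * ρ ^ Finsupp.weight w γ := by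
          rw [Finset.mul_sum]
      _ ≤ ε ^ (N + 1) * F := mul_le_mul_of_nonneg_left
          (hfw.sum_le_tsum _ fun β _ => mul_nonneg (v.nonneg _) (by positivity)) (by positivity)
      _ = ε ^ N * (ε * F) := by ring
      _ ≤ ε ^ N * (a * ρ ^ N / 2) := mul_le_mul_of_nonneg_left hεF (by positivity)
      _ = a * t ^ N / 2 := by rw [ht, mul_pow]; ring
  obtain ⟨G, hG⟩ : ∃ G, ∀ β, v (MvPowerSeries.coeff β (f * h)) * t ^ Finsupp.weight w β ≤ G := by
    refine ⟨∑' β, v (MvPowerSeries.coeff β (f * h)) * ρ ^ Finsupp.weight w β, fun β => ?_⟩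
    refine le_trans ?_ (hgw.le_tsum β fun β _ => mul_nonneg (v.nonneg _) (by positivity))
    refine mul_le_mul_of_nonneg_left (pow_le_pow_left₀ ht0.le ?_ _) (v.nonneg _)
    nlinarith
  -- Chosen to solve G + (a t^N / 2) C = a t^N C, which closes the induction below.
  set C := 2 * G / (a * t ^ N) with hC
  have hCG : G = a * t ^ N * C / 2 := by rw [hC]; field_simp
  refine isConvergent_of_le v (w := w) (C := C) ht0 ht1 ?_
  -- In the coefficient of f h at α + β, every other term with a nonzero coefficient of f uses a
  -- monomial heavier than α, hence a coefficient of h of weight below that of β.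
  have main : ∀ m β, Finsupp.weight w β = m →
      v (MvPowerSeries.coeff β h) * t ^ Finsupp.weight w β ≤ C := by
    intro m
    induction m using Nat.strong_induction_on with
    | _ m ih =>
    intro β hβ
    have hmem : (α, β) ∈ Finset.HasAntidiagonal.antidiagonal (α + β) := by simp
    have hco := MvPowerSeries.coeff_mul (α + β) f h
    rw [← Finset.add_sum_erase _ _ hmem] at hco
    set R := (Finset.HasAntidiagonal.antidiagonal (α + β)).erase (α, β) with hR
    have hv : a * v (MvPowerSeries.coeff β h) ≤ v (MvPowerSeries.coeff (α + β) (f * h)) +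
        ∑ p ∈ R, v (MvPowerSeries.coeff p.1 f) * v (MvPowerSeries.coeff p.2 h) := by
      have e : MvPowerSeries.coeff α f * MvPowerSeries.coeff β h =
          MvPowerSeries.coeff (α + β) (f * h) - ∑ p ∈ R, MvPowerSeries.coeff p.1 f *
            MvPowerSeries.coeff p.2 h := by rw [hco]; ring
      rw [ha, ← map_mul, e]
      refine (v.sub_le_add _ _).trans (add_le_add_right ?_ _)
      refine (v.sum_le _ _).trans (le_of_eq ?_)
      exact Finset.sum_congr rfl fun p _ => map_mul _ _ _
    have hpR : ∀ p ∈ R, p.1 ≠ α ∧ p.1 + p.2 = α + β := by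
      intro p hp
      obtain ⟨hp1, hp2⟩ := Finset.mem_erase.mp hp
      rw [Finset.HasAntidiagonal.mem_antidiagonal] at hp2
      refine ⟨fun h1 => hp1 ?_, hp2⟩
      rw [h1] at hp2
      exact Prod.ext h1 (add_left_cancel hp2)
    have hC0 : 0 ≤ C := by
      have : 0 ≤ G := le_trans (mul_nonneg (v.nonneg _) (by positivity)) (hG 0)
      rw [hC]; positivity
    have hsum : (∑ p ∈ R, v (MvPowerSeries.coeff p.1 f) * v (MvPowerSeries.coeff p.2 h)) *
        t ^ (N + m) ≤ a * t ^ N / 2 * C := by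
      have hinj : Set.InjOn Prod.fst (R : Set ((Fin n →₀ ℕ) × (Fin n →₀ ℕ))) := by
        intro p hp q hq hpq
        refine Prod.ext hpq ?_
        have := (hpR p hp).2.trans (hpR q hq).2.symm
        rw [hpq] at this
        exact add_left_cancel this
      have h1 := htail (R.image Prod.fst) (by
        intro hmem
        obtain ⟨p, hp, hpα⟩ := Finset.mem_image.mp hmem
        exact (hpR p hp).1 hpα)
      rw [Finset.sum_image hinj] at h1
      refine le_trans ?_ (mul_le_mul_of_nonneg_right h1 hC0)
      rw [Finset.sum_mul, Finset.sum_mul]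
      refine Finset.sum_le_sum fun p hp => ?_
      by_cases h0 : MvPowerSeries.coeff p.1 f = 0
      · simp [h0]
      · have hlt := hmin p.1 (hpR p hp).1 h0
        have hsumw := congrArg (Finsupp.weight w) (hpR p hp).2
        rw [map_add, map_add, hβ] at hsumw
        have h2 := ih _ (by omega) p.2 rfl
        have hsplit : t ^ (N + m) = t ^ Finsupp.weight w p.1 * t ^ Finsupp.weight w p.2 := by
          rw [← pow_add, hsumw]
        rw [hsplit]
        calc _ = v (MvPowerSeries.coeff p.1 f) * t ^ Finsupp.weight w p.1 *
              (v (MvPowerSeries.coeff p.2 h) * t ^ Finsupp.weight w p.2) := by ring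
          _ ≤ _ := mul_le_mul_of_nonneg_left h2 (mul_nonneg (v.nonneg _) (by positivity))
    have h3 := hG (α + β)
    rw [map_add, hβ] at h3
    have h4 := mul_le_mul_of_nonneg_right hv (by positivity : (0 : ℝ) ≤ t ^ (N + m))
    rw [add_mul] at h4
    have h5 : a * t ^ N * (v (MvPowerSeries.coeff β h) * t ^ m) ≤ a * t ^ N * C := by
      calc _ = a * v (MvPowerSeries.coeff β h) * t ^ (N + m) := by rw [pow_add]; ring
        _ ≤ G + a * t ^ N / 2 * C := h4.trans (add_le_add h3 hsum)
        _ = _ := by rw [hCG]; ring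
    rw [hβ]
    exact le_of_mul_le_mul_left h5 (by positivity)
  exact fun β => main _ β rfl

end Convergence

/-! ### Closedness of (f) and the chain rule -/

section ChainRule

variable {k : Type*} [Field k] {n : ℕ}

/-- A convergent power series approximated by multiples of `f` to every order is a
multiple of `f`. -/
theorem mem_span_of_forall_approx {v : AbsoluteValue k ℝ} {f : (RingKind.convergent v).ring n}
    (hf0 : f ≠ 0) (g : (RingKind.convergent v).ring n)
    (hg : ∀ N : ℕ, ∃ h : (RingKind.convergent v).ring n, ∀ α : Fin n →₀ ℕ, α.degree < N →
      MvPowerSeries.coeff α (g - f * h).1 = 0) : g ∈ Ideal.span {f} := by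
  classical
  have hf0' : f.1 ≠ 0 := fun h => hf0 (Subtype.ext h)
  choose H hH using hg
  set r := f.1.order.toNat with hr
  have hr' : (r : ℕ∞) = f.1.order := MvPowerSeries.ne_zero_iff_order_finite.mp hf0'
  -- The difference of two approximate quotients, multiplied by f, has order at least N; orders add,
  -- so the difference itself has order at least N - r and the quotients converge coefficientwise.
  have hcauchy : ∀ N M (α : Fin n →₀ ℕ), α.degree + r < N → N ≤ M →
      MvPowerSeries.coeff α (H N).1 = MvPowerSeries.coeff α (H M).1 := by
    intro N M α hα hNM
    have h1 : (N : ℕ∞) ≤ (f.1 * ((H N).1 - (H M).1)).order := by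
      refine MvPowerSeries.nat_le_order fun β hβ => ?_
      have e : f.1 * ((H N).1 - (H M).1) = (g - f * H M).1 - (g - f * H N).1 := by
        push_cast; ring
      rw [e, map_sub, hH M β (hβ.trans_le hNM), hH N β hβ, sub_zero]
    rw [MvPowerSeries.order_mul, ← hr'] at h1
    rw [← sub_eq_zero, ← map_sub]
    refine MvPowerSeries.coeff_of_lt_order ?_
    by_contra hle
    push Not at hle
    have h2 : (N : ℕ∞) ≤ ((r + α.degree : ℕ) : ℕ∞) := by
      push_cast
      exact h1.trans (add_le_add_right hle _)
    have h3 : N ≤ r + α.degree := by exact_mod_cast h2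
    omega
  let h : MvPowerSeries (Fin n) k := fun α => MvPowerSeries.coeff α (H (α.degree + r + 1)).1
  have hfh : f.1 * h = g.1 := by
    ext α
    have h1 := hH (α.degree + r + 1) α (by omega)
    have e : (g - f * H (α.degree + r + 1)).1 = g.1 - f.1 * (H (α.degree + r + 1)).1 := rfl
    rw [e, map_sub, sub_eq_zero] at h1
    rw [h1, MvPowerSeries.coeff_mul, MvPowerSeries.coeff_mul]
    refine Finset.sum_congr rfl fun p hp => ?_
    congr 1
    rw [Finset.HasAntidiagonal.mem_antidiagonal] at hp
    have hd := congrArg Finsupp.degree hp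
    rw [map_add] at hd
    exact hcauchy _ _ _ (by omega) (by omega)
  have hconv : IsConvergent v h := IsConvergent.of_mul hf0' f.2 (hfh ▸ g.2)
  exact Ideal.mem_span_singleton'.mpr
    ⟨⟨h, hconv⟩, Subtype.ext ((mul_comm h f.1).trans hfh)⟩

/-- A convergent power series is a constant plus a combination of the coordinates. -/
theorem exists_eq_add_sum_coord {v : AbsoluteValue k ℝ} (g : (RingKind.convergent v).ring n) :
    ∃ (c : k) (u : Fin n → (RingKind.convergent v).ring n),
      g = algebraMap k _ c + ∑ i, coord _ i * u i := by
  classical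
  -- Each nonconstant monomial is charged to the first variable it contains, so none is counted
  -- twice.
  let u : Fin n → MvPowerSeries (Fin n) k := fun i β =>
    if ∀ j < i, β j = 0 then MvPowerSeries.coeff (β + Finsupp.single i 1) g.1 else 0
  have hu : ∀ i β, MvPowerSeries.coeff β (u i) =
      if ∀ j < i, β j = 0 then MvPowerSeries.coeff (β + Finsupp.single i 1) g.1 else 0 :=
    fun _ _ => rfl
  have hconv : ∀ i, IsConvergent v (u i) := by
    intro i
    obtain ⟨r, hr, hg⟩ := g.2
    refine ⟨r, hr, ?_⟩
    have hinj : Function.Injective fun α : Fin n →₀ ℕ => α + Finsupp.single i 1 :=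
      add_left_injective _
    refine Summable.of_nonneg_of_le (fun β => mul_nonneg (v.nonneg _) (by positivity))
      (fun β => ?_) ((hg.comp_injective hinj).mul_left r⁻¹)
    have e : r⁻¹ * (v (MvPowerSeries.coeff (β + Finsupp.single i 1) g.1) *
        r ^ (β + Finsupp.single i 1).degree) =
        v (MvPowerSeries.coeff (β + Finsupp.single i 1) g.1) * r ^ β.degree := by
      rw [map_add, Finsupp.degree_single, pow_succ]
      field_simp
    refine le_trans ?_ (le_of_eq e.symm)
    rw [hu]
    split_ifs
    · exact le_rfl
    · rw [map_zero, zero_mul]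
      exact mul_nonneg (v.nonneg _) (by positivity)
  refine ⟨MvPowerSeries.coeff 0 g.1, fun i => ⟨u i, hconv i⟩, Subtype.ext ?_⟩
  have hval : (algebraMap k ((RingKind.convergent v).ring n) (MvPowerSeries.coeff 0 g.1) +
      ∑ i, coord _ i * (⟨u i, hconv i⟩ : (RingKind.convergent v).ring n)).1 =
      MvPowerSeries.C (MvPowerSeries.coeff 0 g.1) + ∑ i, MvPowerSeries.X i * u i := by
    push_cast
    rfl
  rw [hval]
  ext α
  have hX : ∀ i, MvPowerSeries.coeff α (MvPowerSeries.X i * u i) =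
      if α i ≠ 0 ∧ ∀ j < i, α j = 0 then MvPowerSeries.coeff α g.1 else 0 := by
    intro i
    rw [MvPowerSeries.X, MvPowerSeries.coeff_monomial_mul]
    by_cases hi : α i = 0
    · rw [if_neg, if_neg (by simp [hi])]
      intro hle
      have := hle i
      simp [hi] at this
    · have hle : Finsupp.single i 1 ≤ α := by
        rw [Finsupp.single_le_iff]; omega
      rw [if_pos hle, one_mul, hu, tsub_add_cancel_of_le hle]
      refine if_congr ?_ rfl rfl
      have hj : ∀ j < i, (α - Finsupp.single i 1 : Fin n →₀ ℕ) j = α j := by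
        intro j hj
        simp [Finsupp.single_eq_of_ne hj.ne]
      constructor
      · exact fun h => ⟨hi, fun j hji => by rw [← hj j hji, h j hji]⟩
      · exact fun h j hji => by rw [hj j hji, h.2 j hji]
  rw [map_add, map_sum, MvPowerSeries.coeff_C]
  simp only [hX]
  by_cases hα : α = 0
  · subst hα
    simp
  · rw [if_neg hα, zero_add]
    have hex : ∃ i, α i ≠ 0 := by
      by_contra hcon
      push Not at hcon
      exact hα (Finsupp.ext hcon)
    have hmin : ∃ i, α i ≠ 0 ∧ ∀ j < i, α j = 0 := by
      obtain ⟨i, hi, hm⟩ := WellFounded.has_min (wellFounded_lt (α := Fin n))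
        {i | α i ≠ 0} hex
      exact ⟨i, hi, fun j hj => by_contra fun h => hm j h hj⟩
    obtain ⟨i, hi, him⟩ := hmin
    rw [Finset.sum_eq_single i, if_pos ⟨hi, him⟩]
    · intro j _ hji
      rw [if_neg]
      rintro ⟨hj, hjm⟩
      rcases lt_or_gt_of_ne hji with h | h
      · exact hj (him j h)
      · exact hi (hjm i h)
    · simp

variable {κ : RingKind k}

/-- The chain rule for derivations of `A`, applied to the relation `f = 0`. -/
theorem sum_derivation_xbar_mul_fbar (f : κ.ring n)
    (δ : Derivation k (HypAlg f) (HypAlg f)) : ∑ i, δ (xbar f i) * fbar f i = 0 := by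
  classical
  -- E is a derivation P → A vanishing on constants and coordinates. Since δ kills the class of f,
  -- the claim amounts to E(f) = 0.
  let E : κ.ring n →ₗ[k] HypAlg f := pull f (δ : HypAlg f →ₗ[k] HypAlg f) -
    ∑ i, δ (xbar f i) • ((proj f).toLinearMap ∘ₗ (partialDer κ i : κ.ring n →ₗ[k] κ.ring n))
  have hE : ∀ g, E g = δ (proj f g) - ∑ i, δ (xbar f i) * proj f (partialDer κ i g) := by
    intro g
    simp [E, pull, LinearMap.sum_apply]
  have hmul : ∀ g h, E (g * h) = proj f g * E h + proj f h * E g := by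
    intro g h
    simp only [hE, map_mul, Derivation.leibniz, smul_eq_mul, map_add, mul_add, mul_sub,
      Finset.sum_add_distrib, Finset.mul_sum]
    have e1 : ∑ i, δ (xbar f i) * (proj f g * proj f (partialDer κ i h)) =
        ∑ i, proj f g * (δ (xbar f i) * proj f (partialDer κ i h)) :=
      Finset.sum_congr rfl fun i _ => by ring
    have e2 : ∑ i, δ (xbar f i) * (proj f h * proj f (partialDer κ i g)) =
        ∑ i, proj f h * (δ (xbar f i) * proj f (partialDer κ i g)) :=
      Finset.sum_congr rfl fun i _ => by ring
    rw [e1, e2]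
    ring
  have hX : ∀ i, E (coord κ i) = 0 := by
    intro i
    rw [hE]
    simp only [partialDer_coord]
    rw [Finset.sum_eq_single i]
    · rw [if_pos rfl, map_one, mul_one]
      exact sub_self _
    · intro j _ hj
      rw [if_neg hj.symm, map_zero, mul_zero]
    · simp
  have hC : ∀ c : k, E (algebraMap k _ c) = 0 := by
    intro c
    rw [hE]
    simp
  have hEf : E f = 0 → ∑ i, δ (xbar f i) * fbar f i = 0 := by
    intro h
    have h0 : proj f f = 0 := (proj_eq_zero_iff f f).mpr (Ideal.mem_span_singleton_self f)
    rw [hE, h0, map_zero, zero_sub, neg_eq_zero] at h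
    exact h
  -- The closedness argument divides by f, so f = 0 is treated apart.
  by_cases hf0 : f = 0
  · refine Finset.sum_eq_zero fun i _ => ?_
    have : fbar f i = 0 := by rw [fbar, hf0, map_zero, map_zero]
    rw [this, mul_zero]
  apply hEf
  cases κ with
  | polynomial =>
    have hpoly : ∀ (p : MvPolynomial (Fin n) k)
        (hp : (p : MvPowerSeries (Fin n) k) ∈ (RingKind.polynomial).ring n), E ⟨p, hp⟩ = 0 := by
      have hmem : ∀ p : MvPolynomial (Fin n) k,
          (p : MvPowerSeries (Fin n) k) ∈ (RingKind.polynomial (k := k)).ring n :=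
        fun p => ⟨p, by simp⟩
      intro p
      induction p using MvPolynomial.induction_on with
      | C c =>
        intro hp
        rw [← hC c]
        congr 1
        exact Subtype.ext (by simp; rfl)
      | add p q hp hq =>
        intro h
        have e : (⟨_, h⟩ : (RingKind.polynomial (k := k)).ring n) =
            ⟨p, hmem p⟩ + ⟨q, hmem q⟩ := Subtype.ext (by simp)
        rw [e, map_add, hp, hq, add_zero]
      | mul_X p i hp =>
        intro h
        have e : (⟨_, h⟩ : (RingKind.polynomial (k := k)).ring n) =
            ⟨p, hmem p⟩ * coord _ i := Subtype.ext (by simp [coord])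
        rw [e, hmul, hp, hX, mul_zero, mul_zero, add_zero]
    obtain ⟨f, p, rfl⟩ := f
    exact hpoly p _
  | convergent v =>
    -- Writing g = c + ∑ x_i q_i gives E(g) = ∑ x_i E(q_i); each iteration raises the order of a
    -- representative by one.
    have happrox : ∀ (N : ℕ) (g : (RingKind.convergent v).ring n),
        ∃ u : (RingKind.convergent v).ring n, proj f u = E g ∧
          ∀ α : Fin n →₀ ℕ, α.degree < N → MvPowerSeries.coeff α u.1 = 0 := by
      intro N
      induction N with
      | zero =>
        intro g
        obtain ⟨u, hu⟩ := proj_surjective f (E g)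
        exact ⟨u, hu, fun α h => absurd h (Nat.not_lt_zero _)⟩
      | succ N ih =>
        intro g
        obtain ⟨c, q, hq⟩ := exists_eq_add_sum_coord g
        choose u hu hu0 using fun i => ih (q i)
        refine ⟨∑ i, coord _ i * u i, ?_, fun α hα => ?_⟩
        · rw [hq, map_add, hC, zero_add, map_sum, map_sum]
          refine Finset.sum_congr rfl fun i _ => ?_
          rw [hmul, hX, mul_zero, add_zero, map_mul, hu]
        · have e : (∑ i, coord _ i * u i : (RingKind.convergent v).ring n).1 =
              ∑ i, MvPowerSeries.X i * (u i).1 := by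
            push_cast; rfl
          rw [e, map_sum]
          refine Finset.sum_eq_zero fun i _ => ?_
          rw [MvPowerSeries.X, MvPowerSeries.coeff_monomial_mul]
          split_ifs with hle
          · rw [hu0, mul_zero]
            have hd := congrArg Finsupp.degree (tsub_add_cancel_of_le hle)
            rw [map_add, Finsupp.degree_single] at hd
            omega
          · rfl
    obtain ⟨g, hg⟩ := proj_surjective f (E f)
    rw [← hg, proj_eq_zero_iff]
    refine mem_span_of_forall_approx hf0 g fun N => ?_
    obtain ⟨u, hu, hu0⟩ := happrox N f
    have h1 : proj f (g - u) = 0 := by rw [map_sub, hg, hu, sub_self]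
    rw [proj_eq_zero_iff] at h1
    obtain ⟨h, hh⟩ := Ideal.mem_span_singleton'.mp h1
    refine ⟨h, fun α hα => ?_⟩
    have e : g - f * h = u := by rw [mul_comm, hh]; ring
    rw [e]
    exact hu0 α hα

end ChainRule

/-! ### Hamiltonian corrections and lifting symmetric tuples -/

section Hypersurface

variable {k : Type*} [Field k] {κ : RingKind k} {n : ℕ}

/-- Evaluation of derivations at an element. -/
def derivationEval (k : Type*) [CommRing k] {A : Type*} [CommRing A] [Algebra k A] (x : A) :
    Derivation k A A →ₗ[A] A where
  toFun δ := δ x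
  map_add' _ _ := rfl
  map_smul' _ _ := rfl

theorem hamiltonian_xbar (f : κ.ring n) (p q j : Fin n) : hamiltonian f p q (xbar f j) =
    (if j = q then fbar f p else 0) - (if j = p then fbar f q else 0) := by
  have h : hamiltonian f p q (xbar f j) = proj f ((partialDer κ p f • partialDer κ q -
      partialDer κ q f • partialDer κ p) (coord κ j)) :=
    Derivation.liftOfSurjective_apply (f := proj f) (proj_surjective f) (proj_hamiltonian f p q) _
  rw [h]
  simp only [Derivation.coe_sub, Derivation.coe_smul, Pi.sub_apply, Pi.smul_apply, smul_eq_mul,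
    partialDer_coord, map_sub, map_mul]
  split_ifs <;> simp [fbar]

/-- D_{pq}(x_i) is nonzero only if exactly one of p, q is i, and then it is, up to sign, the partial
derivative for the other index. -/
theorem apply_xbar_mem_of_mem_span_hamiltonian (f : κ.ring n) (i : Fin n)
    {D : Derivation k (HypAlg f) (HypAlg f)} (hD : D ∈ Submodule.span (HypAlg f)
      {D | ∃ p q, D = hamiltonian f p q}) :
    D (xbar f i) ∈ Ideal.span {a | ∃ j, j ≠ i ∧ a = fbar f j} := by
  induction hD using Submodule.span_induction with
  | zero => exact zero_mem _
  | add D E _ _ hD hE => exact add_mem hD hE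
  | smul a D _ hD => exact Ideal.mul_mem_left _ _ hD
  | mem D hD =>
    obtain ⟨p, q, rfl⟩ := hD
    rw [hamiltonian_xbar]
    by_cases hp : i = p
    · by_cases hq : i = q
      · rw [if_pos hp, if_pos hq, ← hp, ← hq, sub_self]
        exact zero_mem _
      · rw [if_pos hp, if_neg hq, zero_sub]
        exact neg_mem (Ideal.subset_span ⟨q, fun h => hq h.symm, rfl⟩)
    · rw [if_neg hp, sub_zero]
      split_ifs
      · exact Ideal.subset_span ⟨p, fun h => hp h.symm, rfl⟩
      · exact zero_mem _

theorem apply_xbar_notMem_of_sub_mem (f : κ.ring n)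
    {d d' : Fin n → Derivation k (HypAlg f) (HypAlg f)} {i : Fin n}
    (hi : d i (xbar f i) ∉
      coordIdeal f i ^ 2 ⊔ Ideal.span {a | ∃ j, j ≠ i ∧ a = fbar f j})
    (h : d' i - d i ∈ Submodule.span (HypAlg f) {D | ∃ p q, D = hamiltonian f p q}) :
    d' i (xbar f i) ∉ coordIdeal f i ^ 2 := by
  intro hmem
  apply hi
  have h1 := apply_xbar_mem_of_mem_span_hamiltonian f i h
  have e : d i (xbar f i) = d' i (xbar f i) - (d' i - d i) (xbar f i) := by
    rw [Derivation.sub_apply]; ring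
  rw [e]
  exact sub_mem (Ideal.mem_sup_left hmem) (Ideal.mem_sup_right h1)

/-- Tuples which are symmetric modulo the Jacobi ideal can be corrected to symmetric ones by
Hamiltonian derivations. -/
theorem exists_symTuples_sub_mem [CharZero k] (f : κ.ring n)
    (d : Fin n → Derivation k (HypAlg f) (HypAlg f))
    (hd : ∀ i j, d i (xbar f j) - d j (xbar f i) ∈ jacobiIdeal f) :
    ∃ d' ∈ symTuples f, ∀ i, d' i - d i ∈ Submodule.span (HypAlg f)
      {D | ∃ p q, D = hamiltonian f p q} := by
  classical
  have hex : ∀ i j, ∃ b : Fin n → HypAlg f, ∑ l, b l * fbar f l =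
      d i (xbar f j) - d j (xbar f i) := fun i j =>
    Ideal.mem_span_range_iff_exists_fun.mp (hd i j)
  choose b0 hb0 using hex
  obtain ⟨η, hη⟩ : ∃ η : HypAlg f, 2 * η = 1 := by
    refine ⟨algebraMap k _ 2⁻¹, ?_⟩
    rw [← map_ofNat (algebraMap k (HypAlg f)) 2, ← map_mul, mul_inv_cancel₀ two_ne_zero, map_one]
  -- The represented elements are antisymmetric in i, j, so the coefficients may be antisymmetrized.
  let b : Fin n → Fin n → Fin n → HypAlg f := fun i j l => η * (b0 i j l - b0 j i l)
  have hb : ∀ i j, ∑ l, b i j l * fbar f l = d i (xbar f j) - d j (xbar f i) := by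
    intro i j
    have e : ∑ l, b i j l * fbar f l =
        η * (∑ l, b0 i j l * fbar f l - ∑ l, b0 j i l * fbar f l) := by
      rw [← Finset.sum_sub_distrib, Finset.mul_sum]
      exact Finset.sum_congr rfl fun l _ => by ring
    rw [e, hb0, hb0]
    linear_combination (d i (xbar f j) - d j (xbar f i)) * hη
  -- The Koszul formula: it turns antisymmetry of b in the first two indices into antisymmetry of c
  -- in the last two, with c_{ijl} - c_{jil} = -b_{ijl}.
  let c : Fin n → Fin n → Fin n → HypAlg f := fun i j l => -η * (b i j l - b j l i + b l i j)
  have hc1 : ∀ i j l, c i j l = - c i l j := fun i j l => by simp only [c, b]; ring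
  have hc2 : ∀ i j l, c i j l - c j i l = - b i j l := fun i j l => by
    have e : c i j l - c j i l = -(2 * η) * b i j l := by simp only [c, b]; ring
    rw [e, hη, neg_one_mul]
  -- The factor 1/2 is needed because, by antisymmetry of c, both halves of D_{pq}(x_j) contribute
  -- the same sum.
  let d' : Fin n → Derivation k (HypAlg f) (HypAlg f) := fun i =>
    d i + ∑ p, ∑ q, (-η * c i p q) • hamiltonian f p q
  have hval : ∀ i j, d' i (xbar f j) = d i (xbar f j) + ∑ l, c i j l * fbar f l := by
    intro i j
    change derivationEval k (xbar f j) (d i + ∑ p, ∑ q, (-η * c i p q) • hamiltonian f p q) = _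
    simp only [map_add, map_sum, map_smul]
    congr 1
    have e : ∀ p q, (-η * c i p q) • derivationEval k (xbar f j) (hamiltonian f p q) =
        (if j = q then -η * c i p q * fbar f p else 0) -
          (if j = p then -η * c i p q * fbar f q else 0) := by
      intro p q
      change (-η * c i p q) * hamiltonian f p q (xbar f j) = _
      rw [hamiltonian_xbar]
      split_ifs <;> ring
    simp only [e, Finset.sum_sub_distrib]
    rw [Finset.sum_comm (f := fun p q => if j = p then -η * c i p q * fbar f q else 0)]
    simp only [Finset.sum_ite_eq, Finset.mem_univ, if_true]
    rw [← Finset.sum_sub_distrib]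
    refine Finset.sum_congr rfl fun l _ => ?_
    rw [hc1 i l j]
    linear_combination c i j l * fbar f l * hη
  refine ⟨d', fun i j => ?_, fun i => ?_⟩
  · rw [← sub_eq_zero, hval, hval]
    have e : ∑ l, c i j l * fbar f l - ∑ l, c j i l * fbar f l =
        -∑ l, b i j l * fbar f l := by
      rw [← Finset.sum_sub_distrib, ← Finset.sum_neg_distrib]
      refine Finset.sum_congr rfl fun l _ => ?_
      linear_combination fbar f l * hc2 i j l
    rw [hb] at e
    linear_combination e
  · have e : d' i - d i = ∑ p, ∑ q, (-η * c i p q) • hamiltonian f p q := by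
      simp only [d', add_sub_cancel_left]
    rw [e]
    exact Submodule.sum_mem _ fun p _ => Submodule.sum_mem _ fun q _ =>
      Submodule.smul_mem _ _ (Submodule.subset_span ⟨p, q, rfl⟩)

/-- Every symmetric tuple of derivations is the symbol of a second order derivation of `A`. -/
theorem exists_mem_highDer_two_squareDefect [CharZero k] (f : κ.ring n)
    {d : Fin n → Derivation k (HypAlg f) (HypAlg f)} (hd : d ∈ symTuples f) :
    ∃ D ∈ highDer k (HypAlg f) 2, ∀ i, squareDefect k (xbar f i) D = d i (xbar f i) := by
  classical
  -- The lifts are symmetric only modulo f.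
  choose S hS using fun i j => proj_surjective f (d i (xbar f j))
  have hchain : ∀ i, ∑ j, proj f (S i j) * fbar f j = 0 := fun i => by
    simp only [hS]; exact sum_derivation_xbar_mul_fbar f (d i)
  have hsymm : ∀ i j, proj f (S i j) = proj f (S j i) := fun i j => by rw [hS, hS, hd i j]
  have hH : ∀ i, ∃ H, H * f = ∑ j, S i j * partialDer κ j f := by
    intro i
    refine Ideal.mem_span_singleton'.mp ((proj_eq_zero_iff f _).mp ?_)
    rw [map_sum, ← hchain i]
    exact Finset.sum_congr rfl fun j _ => map_mul _ _ _
  choose H hH using hH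
  obtain ⟨η, hη⟩ : ∃ η : κ.ring n, 2 * η = 1 := by
    refine ⟨algebraMap k _ 2⁻¹, ?_⟩
    rw [← map_ofNat (algebraMap k (κ.ring n)) 2, ← map_mul, mul_inv_cancel₀ two_ne_zero, map_one]
  -- Applying ∂_p to ∑_q S_{pq} f_{x_q} = H_p f and summing over p expresses ∑ S_{pq} ∂_p∂_q f
  -- through first derivatives of f, modulo f. U cancels these, leaving T(f) = (f/2) ∑ ∂_p H_p.
  let U : Fin n → κ.ring n := fun i => η * (∑ j, partialDer κ j (S j i) - H i)
  let T : κ.ring n →ₗ[k] κ.ring n :=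
    η • ∑ p, ∑ q, S p q • ((partialDer κ p : κ.ring n →ₗ[k] κ.ring n) ∘ₗ
      (partialDer κ q : κ.ring n →ₗ[k] κ.ring n)) +
    ∑ p, U p • (partialDer κ p : κ.ring n →ₗ[k] κ.ring n)
  have hT : ∀ g, T g = η * ∑ p, ∑ q, S p q * partialDer κ p (partialDer κ q g) +
      ∑ p, U p * partialDer κ p g := by
    intro g
    simp [T, LinearMap.sum_apply]
  have hTmem : T ∈ highDer k (κ.ring n) 2 :=
    add_mem (Submodule.smul_mem _ _ (Submodule.sum_mem _ fun p _ => Submodule.sum_mem _ fun q _ =>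
      Submodule.smul_mem _ _ (derivation_comp_mem_highDer_two _ _)))
      (Submodule.sum_mem _ fun p _ => Submodule.smul_mem _ _ (derivation_mem_highDer_two _))
  have hpf : proj f f = 0 := (proj_eq_zero_iff f f).mpr (Ideal.mem_span_singleton_self f)
  have hTf : proj f (T f) = 0 := by
    have h1 : ∑ p, ∑ q, (S p q * partialDer κ p (partialDer κ q f) +
        partialDer κ p (S p q) * partialDer κ q f) =
        ∑ p, (H p * partialDer κ p f + f * partialDer κ p (H p)) := by
      refine Finset.sum_congr rfl fun p _ => ?_
      have h2 := congrArg (partialDer κ p) (hH p)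
      rw [map_sum] at h2
      simp only [Derivation.leibniz, smul_eq_mul] at h2
      rw [h2]
      exact Finset.sum_congr rfl fun q _ => by ring
    simp only [Finset.sum_add_distrib] at h1
    have h3 : ∑ p, U p * partialDer κ p f =
        η * (∑ p, ∑ q, partialDer κ p (S p q) * partialDer κ q f -
          ∑ p, H p * partialDer κ p f) := by
      rw [Finset.sum_comm, ← Finset.sum_sub_distrib, Finset.mul_sum]
      refine Finset.sum_congr rfl fun p _ => ?_
      rw [← Finset.sum_mul]
      simp only [U]
      ring
    have h4 : T f = f * (η * ∑ p, partialDer κ p (H p)) := by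
      rw [hT, h3]
      rw [← Finset.mul_sum] at h1
      linear_combination η * h1
    rw [h4, map_mul, hpf, zero_mul]
  -- Besides multiples of f and T(f) there are cross terms S_{pq} f_{x_q} g_{x_p} and S_{pq} f_{x_p}
  -- g_{x_q}. The former sum to zero in A by the chain rule, the latter by that and symmetry.
  have hTmul : ∀ g, proj f (T (f * g)) = 0 := by
    intro g
    have h1 : T (f * g) = g * T f + f * T g + η * (∑ p, ∑ q,
        (S p q * partialDer κ p f * partialDer κ q g + S p q * partialDer κ q f *
          partialDer κ p g)) := by
      have hU : ∀ p, U p * partialDer κ p (f * g) =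
          f * (U p * partialDer κ p g) + g * (U p * partialDer κ p f) := fun p => by
        simp only [Derivation.leibniz, smul_eq_mul]
        ring
      have hSS : ∀ p q, S p q * partialDer κ p (partialDer κ q (f * g)) =
          f * (S p q * partialDer κ p (partialDer κ q g)) +
          g * (S p q * partialDer κ p (partialDer κ q f)) +
          (S p q * partialDer κ p f * partialDer κ q g +
            S p q * partialDer κ q f * partialDer κ p g) := fun p q => by
        simp only [Derivation.leibniz, smul_eq_mul, map_add]
        ring
      simp only [hT, hU, hSS, Finset.sum_add_distrib, ← Finset.mul_sum]
      ring
    have h2 : proj f (∑ p, ∑ q, S p q * partialDer κ q f * partialDer κ p g) = 0 := by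
      rw [map_sum]
      refine Finset.sum_eq_zero fun p _ => ?_
      rw [← Finset.sum_mul, map_mul, map_sum]
      have e := hchain p
      rw [Finset.sum_congr rfl fun j _ => map_mul (proj f) (S p j) (partialDer κ j f)]
      change (∑ j, proj f (S p j) * fbar f j) * _ = 0
      rw [e, zero_mul]
    have h3 : proj f (∑ p, ∑ q, S p q * partialDer κ p f * partialDer κ q g) = 0 := by
      rw [← h2, Finset.sum_comm]
      simp only [map_sum, map_mul]
      exact Finset.sum_congr rfl fun p _ => Finset.sum_congr rfl fun q _ => by rw [hsymm q p]
    simp only [Finset.sum_add_distrib] at h1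
    rw [h1]
    simp only [map_add, map_mul (proj f) η, map_mul (proj f) g, map_mul (proj f) f]
    rw [hTf, hpf, h2, h3]
    simp
  have hker : (Ideal.span {f}).restrictScalars k ≤
      LinearMap.ker ((proj f).toLinearMap ∘ₗ T) := by
    intro g hg
    obtain ⟨h, rfl⟩ := Ideal.mem_span_singleton'.mp hg
    rw [LinearMap.mem_ker, mul_comm]
    exact hTmul h
  let D : HypAlg f →ₗ[k] HypAlg f :=
    Submodule.liftQ ((Ideal.span {f}).restrictScalars k) ((proj f).toLinearMap ∘ₗ T) hker
  have hD : ∀ g, D (proj f g) = proj f (T g) := fun g => rfl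
  refine ⟨D, mem_highDer_two_of_surjective (proj_surjective f) hTmem hD, fun i => ?_⟩
  have e : squareDefect k (xbar f i) D = proj f (squareDefect k (coord κ i) T) := by
    simp only [squareDefect_apply, map_sub, map_mul, map_ofNat, ← hD, map_pow]
    rfl
  have hsq : squareDefect k (coord κ i) T = S i i := by
    simp only [T, map_add, map_sum, map_smul, squareDefect_comp, squareDefect_derivation,
      partialDer_coord, smul_eq_mul]
    rw [Finset.sum_eq_single i, Finset.sum_eq_single i]
    · simp only [if_true, mul_one, mul_zero, Finset.sum_const_zero, add_zero]
      linear_combination S i i * hη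
    · intro q _ hq
      simp [hq.symm]
    · simp
    · intro p _ hp
      simp [hp.symm]
    · simp
  rw [e, hsq, hS]

end Hypersurface

end Nakai

end

theorem corollary2p13 {k : Type*} [Field k] [CharZero k] (κ : Nakai.RingKind k) {n : ℕ}
    (f : κ.ring n)
    (d : Fin n → Derivation k (Nakai.HypAlg f) (Nakai.HypAlg f))
    (hd : ∀ i j, d i (Nakai.xbar f j) - d j (Nakai.xbar f i) ∈ Nakai.jacobiIdeal f)
    (hI : ∃ i, d i (Nakai.xbar f i) ∉
      Nakai.coordIdeal f i ^ 2 ⊔ Ideal.span {a | ∃ j, j ≠ i ∧ a = Nakai.fbar f j}) :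
    d ∉ Nakai.thetaImage f ∧
    (∃ d' ∈ Nakai.symTuples f, ∀ i, d' i - d i ∈ Submodule.span (Nakai.HypAlg f)
      {D | ∃ p q, D = Nakai.hamiltonian f p q}) ∧
    (∀ d' ∈ Nakai.symTuples f, (∀ i, d' i - d i ∈ Submodule.span (Nakai.HypAlg f)
      {D | ∃ p q, D = Nakai.hamiltonian f p q}) → d' ∉ Nakai.thetaImage f) ∧
    Nakai.compDer k (Nakai.HypAlg f) 2 ≠ Nakai.highDer k (Nakai.HypAlg f) 2 := by
  obtain ⟨i, hi⟩ := hI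
  have hex := Nakai.exists_symTuples_sub_mem f d hd
  refine ⟨fun h => hi (Ideal.mem_sup_left (Nakai.apply_xbar_mem_of_mem_thetaImage f h i)), hex,
    fun d' _ h hmem => Nakai.apply_xbar_notMem_of_sub_mem f hi (h i)
      (Nakai.apply_xbar_mem_of_mem_thetaImage f hmem i), fun heq => ?_⟩
  obtain ⟨d', hd', h⟩ := hex
  -- The defect of D is compared with I_i² directly, without passing through θ₂.
  obtain ⟨D, hD, hsq⟩ := Nakai.exists_mem_highDer_two_squareDefect f hd'
  refine Nakai.apply_xbar_notMem_of_sub_mem f hi (h i) ?_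
  rw [← hsq i]
  exact Nakai.squareDefect_mem_of_mem_compDer _ (heq ▸ hD)
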